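/- Let $n\ge 1$ and $0<a_1<\cdots<a_n$. For $a>0$ and $j\in\{1,2,\dots\}$ let $F_{a,j}$ be the distribution function of the Erlang law with density $a^{j}x^{j-1}e^{-ax}/(j-1)!$, $x>0$. Let $(X_i)_{i\ge 1}$ be independent, identically distributed non-negative random variables whose common distribution function is of the form $$F(x)=(1-p)+\sum_{i=1}^{n}\sum_{j=1}^{\infty}p_{ij}F_{a_i,j}(x),\qquad x\ge 0,$$ with $p_{ij}\ge 0$ and $p:=\sum_{i=1}^{n}\sum_{j=1}^{\infty}p_{ij}\le 1$. Let $M$ be a random variable with values in $\{0,1,2,\dots\}$, independent of the sequence $(X_i)_{i\ge1}$, and let $G$ be the distribution function of the random sum $\sum_{i=1}^{M}X_i$ (the empty sum being $0$). For $t>0$, $x\ge 0$ and a bounded measurable $g:[0,\infty)\to\mathbb R$ put $$L_tg(x)=E\,g\!\left(\frac{S(tx)}{t}\right),\qquad L_t^{[2]}g(x)=2L_{2t}g(x)-L_tg(x),$$ where $S(0)=0$ and, for $u>0$, $S(u)$ has the gamma density $s^{u-1}e^{-s}/\Gamma(u)$, $s>0$, and, with $[\,\cdot\,]$ denoting the integer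 part, $$M_t^{[2]}g(x)=(tx-[tx])\,L_t^{[2]}g\!\left(\frac{[tx]+1}{t}\right)+([tx]+1-tx)\,L_t^{[2]}g\!\left(\frac{[tx]}{t}\right).$$ Then, for every $t>0$, $$\sup_{x\ge 0}\bigl|M_t^{[2]}G(x)-G(x)\bigr|\le\left(\frac{17}{12}+\frac{27}{16e}\right)\frac{(1-G(0))\,a_n^{2}}{t^{2}}.$$ -/

import Mathlib

open MeasureTheory ProbabilityTheory

open scoped ENNReal

noncomputable section

namespace GammaApprox

/-- The sup-norm `‖f‖ = sup_{x ≥ 0} |f x|` of a real function on `[0, ∞)`, as an extended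
non-negative real (it is `∞` if `f` is unbounded on `[0, ∞)`). -/
def supNorm (f : ℝ → ℝ) : ℝ≥0∞ :=
  ⨆ x : Set.Ici (0 : ℝ), ENNReal.ofReal |f x|

/-- The law of `S u`, where `S` is the standard gamma process: `S 0 = 0`, and for `u > 0` the
variable `S u` has the gamma density with rate `1` and shape `u`. -/
def gammaProcessLaw (u : ℝ) : Measure ℝ :=
  if 0 < u then gammaMeasure u 1 else Measure.dirac 0

/-- The gamma-type operator `L_t g (x) = E g (S (t x) / t)`. -/
def gammaOp (t : ℝ) (g : ℝ → ℝ) (x : ℝ) : ℝ :=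
  ∫ s, g (s / t) ∂(gammaProcessLaw (t * x))

/-- The Richardson extrapolation `L_t^[2] g = 2 L_{2t} g - L_t g`. -/
def gammaOp2 (t : ℝ) (g : ℝ → ℝ) (x : ℝ) : ℝ :=
  2 * gammaOp (2 * t) g x - gammaOp t g x

/-- The operator `M_t^[2]`: linear interpolation of `L_t^[2] g` between the points `k / t`. -/
def interpOp2 (t : ℝ) (g : ℝ → ℝ) (x : ℝ) : ℝ :=
  (t * x - (⌊t * x⌋ : ℝ)) * gammaOp2 t g (((⌊t * x⌋ : ℝ) + 1) / t) +
    ((⌊t * x⌋ : ℝ) + 1 - t * x) * gammaOp2 t g ((⌊t * x⌋ : ℝ) / t)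

/-- The distribution function of an Erlang law with scale parameter `a` and shape `j`, i.e. of the
law with density `a ^ j * x ^ (j - 1) * exp (-a x) / (j - 1)!` for `x > 0`. -/
def erlangCDF (a : ℝ) (j : ℕ) (x : ℝ) : ℝ :=
  cdf (gammaMeasure j a) x

/-- The class `ME(a_1, …, a_n)` of (possibly infinite) mixtures of Erlang distributions with scale
parameters `a i`, allowing a point mass at `0`. The number `w i j` is the weight of the Erlang
distribution with scale `a i` and shape `j + 1`, so that the shapes are `1, 2, 3, …`. -/
def IsErlangMixture {n : ℕ} (a : Fin n → ℝ) (F : ℝ → ℝ) : Prop :=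
  ∃ w : Fin n → ℕ → ℝ,
    (∀ i j, 0 ≤ w i j) ∧ (∀ i, Summable (w i)) ∧ ∑ i, ∑' j, w i j ≤ 1 ∧
      ∀ x, 0 ≤ x →
        F x = (1 - ∑ i, ∑' j, w i j) + ∑ i, ∑' j, w i j * erlangCDF (a i) (j + 1) x

/-- The random sum of the first `M` terms of a sequence (the empty sum is `0`); the terms of the
sequence are numbered `X 0, X 1, X 2, …`. -/
def randomSum {Ω : Type*} (X : ℕ → Ω → ℝ) (M : Ω → ℕ) (ω : Ω) : ℝ :=
  ∑ i ∈ Finset.range (M ω), X i ω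

/-- The distribution function of a real random variable. -/
def distFun {Ω : Type*} [MeasurableSpace Ω] (μ : Measure Ω) (Y : Ω → ℝ) (x : ℝ) : ℝ :=
  cdf (μ.map Y) x

end GammaApprox

end

/-!
The proof reduces the claim to a single Erlang law and then estimates the error for that law.

An exponential variable of rate `b ≤ A` is a geometric sum of exponential variables of rate `A`, so
every Erlang law of rate `a i` is a mixture of Erlang laws of the largest rate `A`. Mixtures of
Erlang laws of rate `A` and of the point mass at `0` are stable under convolution and under further
mixing, hence the law of the random sum is again of this kind: `G` is a convex combination of the
distribution functions `erlangCDF A j` and of the constant `1`, the latter with the weight `G 0`.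
The operators are linear, reproduce constants and respect the change of scale, so it remains to
bound the error for one Erlang law of rate `1`, which is `abs_interpOp2_erlangCDF_one_sub_le`.

For `t ≤ 1` the claimed bound is larger than the trivial bound `2`. For `t ≥ 1`, linear
interpolation costs `1 / (8 t ^ 2)`, because the second derivative of the distribution function is a
difference of two Poisson weights and so at most `1` in absolute value. At the points `x = k / t`
the function is expanded at `x` to third order. The Richardson combination removes the terms of
order `1 / t` and leaves `x / (6 t ^ 2)` times the third derivative, together with a remainder
controlled by the fourth derivative and the fourth centred moment of the gamma law
(`abs_gammaOp2_sub_le`).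

The derivatives of an Erlang distribution function are differences of Poisson weights in the
index, because the generating function of the weights with mean `y` is `exp (y (z - 1))`. The
second differences have `ℓ¹`-norm at most `√2 / y`, by orthogonality of the Charlier polynomials
(`mul_sum_abs_poissonDiff_two_le`), and the first differences have sup-norm at most
`1 / (√(2 e) y)`, by log-concavity of their explicit form (`abs_mul_poissonDiff_one_le`).
Writing the Poisson weights with mean `y` as a convolution of those with mean `y / 2`
combines the two into the bound `4 / √e` for `y ^ 2` times the fourth derivative at `y`
(`sq_mul_abs_poissonDiff_three_le`). With these constants the total stays below
`17 / 12 + 27 / (16 e)`.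
-/

namespace GammaApprox

/-! ### Poisson weights and their differences -/

/-- The Poisson weights with mean `y`, as a power series. Multiplying it by `X - 1` is taking
(minus) the backward difference of the weights, and it is also differentiating in `y`. -/
noncomputable def poissonSeries (y : ℝ) : PowerSeries ℝ :=
  PowerSeries.C (Real.exp (-y)) * PowerSeries.rescale y (PowerSeries.exp ℝ)

/-- The `m`-th coefficient of the `i`-th difference of the Poisson weights with mean `y`, equal to
the `i`-th derivative in `y` of the `m`-th Poisson weight. -/
noncomputable def poissonDiff (i m : ℕ) (y : ℝ) : ℝ :=
  PowerSeries.coeff m ((PowerSeries.X - 1) ^ i * poissonSeries y)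

lemma poissonDiff_zero (m : ℕ) (y : ℝ) :
    poissonDiff 0 m y = Real.exp (-y) * (y ^ m / m.factorial) := by
  simp [poissonDiff, poissonSeries, PowerSeries.coeff_rescale, PowerSeries.coeff_exp,
    div_eq_mul_inv]

lemma poissonDiff_succ_zero (i : ℕ) (y : ℝ) : poissonDiff (i + 1) 0 y = -poissonDiff i 0 y := by
  simp [poissonDiff, pow_succ', mul_assoc]

lemma poissonDiff_succ_succ (i m : ℕ) (y : ℝ) :
    poissonDiff (i + 1) (m + 1) y = poissonDiff i m y - poissonDiff i (m + 1) y := by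
  simp [poissonDiff, pow_succ', mul_assoc, sub_mul, PowerSeries.coeff_succ_X_mul]

lemma poissonDiff_nonneg (m : ℕ) {y : ℝ} (hy : 0 ≤ y) : 0 ≤ poissonDiff 0 m y := by
  rw [poissonDiff_zero]; positivity

lemma poissonSeries_add (x y : ℝ) :
    poissonSeries (x + y) = poissonSeries x * poissonSeries y := by
  have h := PowerSeries.exp_mul_exp_eq_exp_add (A := ℝ) x y
  simp only [poissonSeries, ← h, neg_add, Real.exp_add, map_mul]
  ring

lemma poissonDiff_add (i k m : ℕ) (x y : ℝ) :
    poissonDiff (i + k) m (x + y) =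
      ∑ p ∈ Finset.HasAntidiagonal.antidiagonal m, poissonDiff i p.1 x * poissonDiff k p.2 y := by
  have : (PowerSeries.X - 1 : PowerSeries ℝ) ^ (i + k) * poissonSeries (x + y) =
      ((PowerSeries.X - 1) ^ i * poissonSeries x) *
        ((PowerSeries.X - 1) ^ k * poissonSeries y) := by
    rw [poissonSeries_add, pow_add]; ring
  rw [poissonDiff, this, PowerSeries.coeff_mul]
  rfl

lemma hasDerivAt_poissonDiff (i m : ℕ) (y : ℝ) :
    HasDerivAt (poissonDiff i m) (poissonDiff (i + 1) m y) y := by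
  induction i generalizing m with
  | zero =>
    have hE : HasDerivAt (fun y : ℝ => Real.exp (-y)) (-Real.exp (-y)) y := by
      simpa using (hasDerivAt_neg y).exp
    have h0 : poissonDiff 0 m = fun y => Real.exp (-y) * (y ^ m / m.factorial) :=
      funext (poissonDiff_zero m)
    rw [h0]
    cases m with
    | zero =>
      rw [poissonDiff_succ_zero, poissonDiff_zero]
      simpa using hE
    | succ m =>
      rw [poissonDiff_succ_succ, poissonDiff_zero, poissonDiff_zero]
      refine (hE.mul ((hasDerivAt_pow (m + 1) y).div_const ((m + 1).factorial : ℝ))).congr_deriv ?_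
      have : (m.factorial : ℝ) ≠ 0 := by positivity
      push_cast [Nat.factorial_succ]
      field_simp
      ring
  | succ i ih =>
    cases m with
    | zero =>
      have h0 : poissonDiff (i + 1) 0 = fun y => -poissonDiff i 0 y :=
        funext (poissonDiff_succ_zero i)
      rw [h0, poissonDiff_succ_zero (i + 1)]
      exact (ih 0).neg
    | succ m =>
      have h0 : poissonDiff (i + 1) (m + 1) =
          fun y => poissonDiff i m y - poissonDiff i (m + 1) y :=
        funext (poissonDiff_succ_succ i m)
      rw [h0, poissonDiff_succ_succ (i + 1)]
      exact (ih m).sub (ih (m + 1))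

lemma succ_mul_poissonDiff (m : ℕ) (y : ℝ) :
    (m + 1) * poissonDiff 0 (m + 1) y = y * poissonDiff 0 m y := by
  rw [poissonDiff_zero, poissonDiff_zero]
  have : (m.factorial : ℝ) ≠ 0 := by positivity
  push_cast [Nat.factorial_succ]
  field_simp
  ring

lemma mul_poissonDiff_one (m : ℕ) (y : ℝ) :
    y * poissonDiff 1 m y = (m - y) * poissonDiff 0 m y := by
  cases m with
  | zero => rw [poissonDiff_succ_zero]; push_cast; ring
  | succ m =>
    rw [poissonDiff_succ_succ]
    have := succ_mul_poissonDiff m y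
    push_cast
    linear_combination -this

lemma mul_poissonDiff_two (m : ℕ) (y : ℝ) :
    y ^ 2 * poissonDiff 2 m y = ((m - y) ^ 2 - m) * poissonDiff 0 m y := by
  rcases m with _ | m
  · rw [poissonDiff_succ_zero, poissonDiff_succ_zero]; push_cast; ring
  · rw [poissonDiff_succ_succ]
    have h1 := mul_poissonDiff_one m y
    have h2 := mul_poissonDiff_one (m + 1) y
    have h3 := succ_mul_poissonDiff m y
    push_cast at *
    linear_combination y * h1 - y * h2 + (y - m) * h3

lemma hasSum_descFactorial_mul_poissonDiff (k : ℕ) (y : ℝ) :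
    HasSum (fun m : ℕ => (m.descFactorial k : ℝ) * poissonDiff 0 m y) (y ^ k) := by
  have h0 : HasSum (fun m : ℕ => poissonDiff 0 m y) 1 := by
    have := (NormedSpace.expSeries_div_hasSum_exp (𝔸 := ℝ) y).mul_left (Real.exp (-y))
    simp only [← Real.exp_eq_exp_ℝ] at this
    rw [← Real.exp_add] at this
    simpa [poissonDiff_zero] using this
  rw [← hasSum_nat_add_iff' k]
  have hz : ∑ i ∈ Finset.range k, (i.descFactorial k : ℝ) * poissonDiff 0 i y = 0 := by
    refine Finset.sum_eq_zero fun i hi => ?_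
    rw [Nat.descFactorial_of_lt (Finset.mem_range.1 hi)]; simp
  rw [hz, sub_zero]
  have hf : (fun m : ℕ => ((m + k).descFactorial k : ℝ) * poissonDiff 0 (m + k) y) =
      fun m => y ^ k * poissonDiff 0 m y := by
    funext m
    rw [poissonDiff_zero, poissonDiff_zero]
    have h := Nat.factorial_mul_descFactorial (Nat.le_add_left k m)
    rw [Nat.add_sub_cancel] at h
    rw [← h]
    have : (m.factorial : ℝ) ≠ 0 := by positivity
    have : ((m + k).descFactorial k : ℝ) ≠ 0 := by
      have := Nat.descFactorial_pos.2 (Nat.le_add_left k m)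
      positivity
    push_cast
    field_simp
    ring
  rw [hf]
  simpa using h0.mul_left (y ^ k)

lemma sum_poissonDiff_le_one (s : Finset ℕ) {y : ℝ} (hy : 0 ≤ y) :
    ∑ m ∈ s, poissonDiff 0 m y ≤ 1 := by
  have h := hasSum_descFactorial_mul_poissonDiff 0 y
  simp only [Nat.descFactorial_zero, Nat.cast_one, one_mul, pow_zero] at h
  exact sum_le_hasSum s (fun m _ => poissonDiff_nonneg m hy) h

/-- The second moment of the second Charlier polynomial under the Poisson law. -/
lemma hasSum_charlier_sq (y : ℝ) :
    HasSum (fun m : ℕ => ((m - y) ^ 2 - m) ^ 2 * poissonDiff 0 m y) (2 * y ^ 2) := by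
  have h := fun k => hasSum_descFactorial_mul_poissonDiff k y
  have H := ((((h 4).add ((h 3).mul_left (4 - 4 * y))).add
    ((h 2).mul_left (2 + 6 * y ^ 2 - 8 * y))).add ((h 1).mul_left (4 * y ^ 2 - 4 * y ^ 3))).add
    ((h 0).mul_left (y ^ 4))
  convert H using 1
  · funext m
    have e1 : (m.descFactorial 1 : ℝ) = m := by simp
    have e2 : (m.descFactorial 2 : ℝ) = m * (m - 1) := by
      rcases m with _ | m
      · simp
      · simp [Nat.descFactorial_succ]; ring
    have e3 : (m.descFactorial 3 : ℝ) = m * (m - 1) * (m - 2) := by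
      rcases m with _ | _ | m
      · simp
      · simp
      · simp [Nat.descFactorial_succ]; ring
    have e4 : (m.descFactorial 4 : ℝ) = m * (m - 1) * (m - 2) * (m - 3) := by
      rcases m with _ | _ | _ | m
      · simp
      · simp
      · simp
      · simp [Nat.descFactorial_succ]; ring
    rw [e1, e2, e3, e4]
    simp only [Nat.descFactorial_zero, Nat.cast_one]
    ring
  · ring

/-- By the Cauchy–Schwarz inequality and `hasSum_charlier_sq`, the second differences of the
Poisson weights with mean `y` have `ℓ¹`-norm at most `√2 / y`. -/
lemma mul_sum_abs_poissonDiff_two_le (s : Finset ℕ) {y : ℝ} (hy : 0 < y) :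
    y * ∑ m ∈ s, |poissonDiff 2 m y| ≤ √2 := by
  have hCS := Finset.sum_sq_le_sum_mul_sum_of_sq_le_mul s
    (r := fun m => |y ^ 2 * poissonDiff 2 m y|)
    (f := fun m => ((m - y) ^ 2 - m) ^ 2 * poissonDiff 0 m y) (g := fun m => poissonDiff 0 m y)
    (fun m _ => mul_nonneg (sq_nonneg _) (poissonDiff_nonneg m hy.le))
    (fun m _ => poissonDiff_nonneg m hy.le)
    (fun m _ => by rw [sq_abs, mul_poissonDiff_two]; exact le_of_eq (by ring))
  have h1 := sum_poissonDiff_le_one s hy.le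
  have h2 := sum_le_hasSum s
    (fun m _ => mul_nonneg (sq_nonneg _) (poissonDiff_nonneg m hy.le)) (hasSum_charlier_sq y)
  have h3 : 0 ≤ ∑ m ∈ s, poissonDiff 0 m y :=
    Finset.sum_nonneg fun m _ => poissonDiff_nonneg m hy.le
  have e : ∑ m ∈ s, |y ^ 2 * poissonDiff 2 m y| = y * (y * ∑ m ∈ s, |poissonDiff 2 m y|) := by
    simp_rw [abs_mul, ← Finset.mul_sum, abs_of_pos (pow_pos hy 2)]
    ring
  rw [e] at hCS
  apply Real.le_sqrt_of_sq_le
  have h4 : (y * (y * ∑ m ∈ s, |poissonDiff 2 m y|)) ^ 2 ≤ 2 * y ^ 2 * 1 :=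
    hCS.trans (mul_le_mul h2 h1 h3 (by positivity))
  have : y ^ 2 * (y * ∑ m ∈ s, |poissonDiff 2 m y|) ^ 2 ≤ y ^ 2 * 2 := by linarith
  exact le_of_mul_le_mul_left this (by positivity)

/-- The integral form of this inequality is `∫ log ≤ log n` over the unit interval centred
at `n`. -/
lemma mul_log_add_half_le (n : ℝ) (hn : 1 ≤ n) :
    (n + 1 / 2) * Real.log (n + 1 / 2) ≤
      (n - 1 / 2) * Real.log (n - 1 / 2) + 1 + Real.log n := by
  set h : ℝ → ℝ := fun v => (n + v) * Real.log (n + v) - (n - v) * Real.log (n - v)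
    - 2 * v * (1 + Real.log n) with hh
  have hd : ∀ v ∈ Set.Icc (0 : ℝ) (1 / 2), HasDerivAt h
      (Real.log (n + v) + Real.log (n - v) - 2 * Real.log n) v := by
    intro v hv
    have h1 : n + v ≠ 0 := by linarith [hv.1]
    have h2 : n - v ≠ 0 := by linarith [hv.2]
    have a1 : HasDerivAt (fun v : ℝ => n + v) 1 v := (hasDerivAt_id v).const_add n
    have a2 : HasDerivAt (fun v : ℝ => n - v) (-1) v := (hasDerivAt_id v).const_sub n
    refine ((((Real.hasDerivAt_mul_log h1).comp v a1).sub
      ((Real.hasDerivAt_mul_log h2).comp v a2)).sub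
      (((hasDerivAt_id v).const_mul 2).mul_const (1 + Real.log n))).congr_deriv ?_
    ring
  have hanti : AntitoneOn h (Set.Icc 0 (1 / 2)) := by
    refine antitoneOn_of_deriv_nonpos (convex_Icc _ _)
      (fun v hv => (hd v hv).continuousAt.continuousWithinAt)
      (fun v hv => (hd v (interior_subset hv)).differentiableAt.differentiableWithinAt) ?_
    intro v hv
    have hv' := interior_subset hv
    rw [(hd v hv').deriv, ← Real.log_mul (by linarith [hv'.1]) (by linarith [hv'.2])]
    have : Real.log ((n + v) * (n - v)) ≤ Real.log (n ^ 2) :=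
      Real.log_le_log (mul_pos (by linarith [hv'.1]) (by linarith [hv'.2]))
        (by nlinarith [sq_nonneg v])
    rw [Real.log_pow] at this
    push_cast at this
    linarith
  have := hanti (Set.left_mem_Icc.2 (by norm_num)) (Set.right_mem_Icc.2 (by norm_num))
    (by norm_num)
  simp only [hh] at this
  norm_num at this ⊢
  linarith

/-- The maximum over `y` of `√y * y ^ m * exp (-y) / m!`, attained at `y = m + 1 / 2`, decreases
in `m`, so it is largest for `m = 0`. -/
lemma exp_mul_log_sub_le_factorial (m : ℕ) :
    Real.exp ((m + 1 / 2) * Real.log (m + 1 / 2) - (m + 1 / 2)) ≤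
      m.factorial * (Real.exp (-1 / 2) / √2) := by
  induction m with
  | zero =>
    have : Real.exp (1 / 2 * Real.log (1 / 2)) = 1 / √2 := by
      rw [mul_comm, ← Real.rpow_def_of_pos (by norm_num), ← Real.sqrt_eq_rpow]
      simp
    simp only [Nat.cast_zero, zero_add, Nat.factorial_zero, Nat.cast_one, one_mul]
    rw [sub_eq_add_neg, Real.exp_add, this, show (-(1 / 2) : ℝ) = -1 / 2 by norm_num]
    exact le_of_eq (by ring)
  | succ m ih =>
    have h := mul_log_add_half_le (m + 1) (by linarith [Nat.cast_nonneg (α := ℝ) m])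
    rw [show (m : ℝ) + 1 - 1 / 2 = m + 1 / 2 by ring] at h
    have hm : (0 : ℝ) < m + 1 := by positivity
    push_cast [Nat.factorial_succ]
    calc Real.exp (((m : ℝ) + 1 + 1 / 2) * Real.log (m + 1 + 1 / 2) - (m + 1 + 1 / 2))
        ≤ Real.exp (Real.log (m + 1) + ((m + 1 / 2) * Real.log (m + 1 / 2) - (m + 1 / 2))) :=
          Real.exp_le_exp.2 (by linarith)
      _ = (m + 1) * Real.exp ((m + 1 / 2) * Real.log (m + 1 / 2) - (m + 1 / 2)) := by
          rw [Real.exp_add, Real.exp_log hm]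
      _ ≤ (m + 1) * (m.factorial * (Real.exp (-1 / 2) / √2)) :=
          mul_le_mul_of_nonneg_left ih hm.le
      _ = _ := by ring

/-- The bound `1 / √(2 e)` for `√y` times a Poisson weight with mean `y = σ ^ 2`, in exponential
form. -/
lemma exp_two_mul_add_one_log_sub_sq_le (m : ℕ) {σ : ℝ} (hσ : 0 < σ) :
    Real.exp ((2 * m + 1) * Real.log σ - σ ^ 2) ≤ m.factorial * (Real.exp (-1 / 2) / √2) := by
  refine le_trans (Real.exp_le_exp.2 ?_) (exp_mul_log_sub_le_factorial m)
  have hc : (0 : ℝ) < m + 1 / 2 := by positivity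
  have h := Real.log_le_sub_one_of_pos (show 0 < σ ^ 2 / (m + 1 / 2) by positivity)
  rw [Real.log_div (by positivity) hc.ne', Real.log_pow] at h
  have h2 := mul_le_mul_of_nonneg_left h hc.le
  rw [mul_sub, mul_sub, mul_div_cancel₀ _ hc.ne'] at h2
  push_cast at h2
  linarith

/-- The function `|y - m| * y ^ m * exp (-y)` is log-concave on either side of `m`, so it lies below
its value at the critical point `σ ^ 2`, where `(σ ^ 2 - m) ^ 2 = σ ^ 2`; the sign `ε` is that of
`y - m`. -/
lemma abs_sub_mul_exp_le (m : ℕ) {y σ ε : ℝ} (hy : 0 < y) (hσ : 0 < σ) (hε : ε ^ 2 = 1)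
    (hm : (m : ℝ) = σ ^ 2 - ε * σ) (hd : 0 < ε * (y - m)) :
    ε * (y - m) * (Real.exp (-y) * y ^ m) ≤ Real.exp ((2 * m + 1) * Real.log σ - σ ^ 2) := by
  have h1 := Real.log_le_sub_one_of_pos (div_pos hd hσ)
  have h2 := Real.log_le_sub_one_of_pos (show 0 < y / σ ^ 2 by positivity)
  rw [Real.log_div hd.ne' hσ.ne'] at h1
  rw [Real.log_div hy.ne' (by positivity), Real.log_pow] at h2
  have h3 := mul_le_mul_of_nonneg_left h2 (Nat.cast_nonneg (α := ℝ) m)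
  have e : ε * (y - m) * (Real.exp (-y) * y ^ m) =
      Real.exp (Real.log (ε * (y - m)) + (-y + m * Real.log y)) := by
    rw [Real.exp_add, Real.exp_add, Real.exp_log hd, ← Real.log_pow, Real.exp_log (by positivity)]
  rw [e]
  refine Real.exp_le_exp.2 ?_
  have key : ε * (y - m) / σ - 1 + m * (y / σ ^ 2 - 1) = y - σ ^ 2 := by
    rw [hm]
    field_simp
    linear_combination σ * hε
  push_cast at h3
  linarith

/-- The first differences of the Poisson weights with mean `y` are at most `1 / (√(2 e) y)`. -/
lemma abs_mul_poissonDiff_one_le (m : ℕ) {y : ℝ} (hy : 0 < y) :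
    |y * poissonDiff 1 m y| ≤ Real.exp (-1 / 2) / √2 := by
  have hC : 0 ≤ Real.exp (-1 / 2) / √2 := by positivity
  have hfac : (0 : ℝ) < m.factorial := by positivity
  rw [mul_poissonDiff_one, poissonDiff_zero]
  -- the critical points `y = σ ^ 2` solve `(y - m) ^ 2 = y`, that is `σ ^ 2 - ε σ = m`
  have main : ∀ σ ε : ℝ, 0 < σ → ε ^ 2 = 1 → (m : ℝ) = σ ^ 2 - ε * σ → 0 < ε * (y - m) →
      ε * (y - m) * (Real.exp (-y) * (y ^ m / m.factorial)) ≤ Real.exp (-1 / 2) / √2 := by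
    intro σ ε hσ hε hm hd
    have h := (abs_sub_mul_exp_le m hy hσ hε hm hd).trans (exp_two_mul_add_one_log_sub_sq_le m hσ)
    rw [← mul_div_assoc, ← mul_div_assoc, div_le_iff₀ hfac]
    linarith
  have hpos : 0 ≤ Real.exp (-y) * (y ^ m / m.factorial) := by positivity
  have hs : √(1 + 4 * m) ^ 2 = 1 + 4 * (m : ℝ) := Real.sq_sqrt (by positivity)
  rw [abs_mul, abs_of_nonneg hpos]
  rcases lt_trichotomy y m with h | h | h
  · have hm0 : (0 : ℝ) < m := hy.trans h
    have hgt : 1 < √(1 + 4 * m) := by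
      rw [Real.lt_sqrt (by norm_num)]; linarith
    have := main ((√(1 + 4 * m) - 1) / 2) (-1) (by linarith) (by norm_num) (by linarith)
      (by linarith)
    rw [abs_of_pos (by linarith)]
    linarith
  · simp [h, hC]
  · have := main ((√(1 + 4 * m) + 1) / 2) 1 (by positivity) (by norm_num) (by linarith)
      (by linarith)
    rw [abs_of_neg (by linarith)]
    linarith

lemma abs_poissonDiff_one_le_one (m : ℕ) {y : ℝ} (hy : 0 ≤ y) : |poissonDiff 1 m y| ≤ 1 := by
  have h1 := fun k => sum_poissonDiff_le_one {k} hy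
  have h0 := fun k => poissonDiff_nonneg k hy
  simp only [Finset.sum_singleton] at h1
  rcases m with _ | m
  · rw [poissonDiff_succ_zero, abs_neg, abs_of_nonneg (h0 0)]
    exact h1 0
  · rw [poissonDiff_succ_succ, abs_le]
    constructor <;> linarith [h0 m, h0 (m + 1), h1 m, h1 (m + 1)]

lemma abs_poissonDiff_three_le_three (m : ℕ) {y : ℝ} (hy : 0 ≤ y) : |poissonDiff 3 m y| ≤ 3 := by
  have h0 := fun k => poissonDiff_nonneg k hy
  rcases m with _ | _ | _ | m
  · have := sum_poissonDiff_le_one {0} hy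
    simp only [Finset.sum_singleton] at this
    simp only [poissonDiff_succ_zero, abs_neg]
    rw [abs_of_nonneg (h0 0)]
    linarith
  · have := sum_poissonDiff_le_one (Finset.range 2) hy
    simp only [Finset.sum_range_succ, Finset.sum_range_zero] at this
    simp only [poissonDiff_succ_zero, poissonDiff_succ_succ]
    rw [abs_le]
    constructor <;> linarith [h0 0, h0 1]
  · have := sum_poissonDiff_le_one (Finset.range 3) hy
    simp only [Finset.sum_range_succ, Finset.sum_range_zero] at this
    simp only [poissonDiff_succ_zero, poissonDiff_succ_succ]
    rw [abs_le]
    constructor <;> linarith [h0 0, h0 1, h0 2]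
  · have := sum_poissonDiff_le_one ((Finset.range 4).map (addLeftEmbedding m)) hy
    simp only [Finset.sum_map, Finset.sum_range_succ, Finset.sum_range_zero,
      addLeftEmbedding_apply, add_zero] at this
    simp only [poissonDiff_succ_succ]
    simp only [add_assoc, Nat.reduceAdd] at *
    rw [abs_le]
    constructor <;> linarith [h0 m, h0 (m + 1), h0 (m + 2), h0 (m + 3)]

lemma abs_mul_poissonDiff_two_le (m : ℕ) {y : ℝ} (hy : 0 < y) :
    |y * poissonDiff 2 m y| ≤ √2 := by
  simpa [abs_mul, abs_of_pos hy] using mul_sum_abs_poissonDiff_two_le {m} hy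

/-- Splitting the mean into two halves turns the third difference into the convolution of a second
and a first difference, which are bounded in `ℓ¹` and in `ℓ^∞`. -/
lemma sq_mul_abs_poissonDiff_three_le (m : ℕ) {y : ℝ} (hy : 0 < y) :
    y ^ 2 * |poissonDiff 3 m y| ≤ 4 * Real.exp (-1 / 2) := by
  have hz : 0 < y / 2 := by positivity
  have hsum : poissonDiff 3 m y = ∑ p ∈ Finset.HasAntidiagonal.antidiagonal m,
      poissonDiff 2 p.1 (y / 2) * poissonDiff 1 p.2 (y / 2) := by
    have := poissonDiff_add 2 1 m (y / 2) (y / 2)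
    rwa [add_halves] at this
  have h1 : |poissonDiff 3 m y| ≤ ∑ p ∈ Finset.HasAntidiagonal.antidiagonal m,
      |poissonDiff 2 p.1 (y / 2)| * (Real.exp (-1 / 2) / √2 / (y / 2)) := by
    rw [hsum]
    refine (Finset.abs_sum_le_sum_abs _ _).trans (Finset.sum_le_sum fun p _ => ?_)
    rw [abs_mul]
    refine mul_le_mul_of_nonneg_left ?_ (abs_nonneg _)
    rw [le_div_iff₀ hz, mul_comm, ← abs_of_pos hz, ← abs_mul, abs_of_pos hz]
    exact abs_mul_poissonDiff_one_le _ hz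
  rw [← Finset.sum_mul, Finset.Nat.sum_antidiagonal_eq_sum_range_succ_mk] at h1
  have h2 := mul_sum_abs_poissonDiff_two_le (Finset.range m.succ) hz
  set S := ∑ k ∈ Finset.range m.succ, |poissonDiff 2 k (y / 2)|
  have hs2 : √2 ≠ 0 := by positivity
  calc y ^ 2 * |poissonDiff 3 m y| ≤ y ^ 2 * (S * (Real.exp (-1 / 2) / √2 / (y / 2))) :=
        mul_le_mul_of_nonneg_left h1 (by positivity)
    _ = (y / 2 * S) * (4 * (Real.exp (-1 / 2) / √2)) := by field_simp; ring
    _ ≤ √2 * (4 * (Real.exp (-1 / 2) / √2)) := mul_le_mul_of_nonneg_right h2 (by positivity)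
    _ = 4 * Real.exp (-1 / 2) := by field_simp

/-! ### Taylor expansion to third order -/

/-- A differential inequality along the segment from `s` to `x`, integrated from `s`. -/
lemma abs_le_of_abs_deriv_mul_le {Φ B Φ' B' : ℝ → ℝ} {x s : ℝ}
    (hΦ : ∀ ξ, HasDerivAt Φ (Φ' ξ) ξ) (hB : ∀ ξ, HasDerivAt B (B' ξ) ξ)
    (hΦs : Φ s = 0) (hBs : B s = 0)
    (h : ∀ ξ ∈ Set.uIcc s x, |Φ' ξ| * |ξ - s| ≤ B' ξ * (ξ - s)) : |Φ x| ≤ B x := by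
  set γ : ℝ → ℝ := fun τ => s + τ * (x - s) with hγ
  have hγ' : ∀ τ, HasDerivAt γ (x - s) τ := fun τ => by
    exact (((hasDerivAt_id τ).mul_const (x - s)).const_add s).congr_deriv (one_mul _)
  have key : ∀ ε : ℝ, |ε| = 1 → 0 ≤ B x + ε * Φ x := by
    intro ε hε
    have hd : ∀ τ, HasDerivAt (fun τ => B (γ τ) + ε * Φ (γ τ))
        (B' (γ τ) * (x - s) + ε * (Φ' (γ τ) * (x - s))) τ := fun τ =>
      ((hB _).comp τ (hγ' τ)).add (((hΦ _).comp τ (hγ' τ)).const_mul ε)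
    have hmono : MonotoneOn (fun τ => B (γ τ) + ε * Φ (γ τ)) (Set.Icc 0 1) := by
      refine monotoneOn_of_deriv_nonneg (convex_Icc _ _)
        (fun τ _ => (hd τ).continuousAt.continuousWithinAt)
        (fun τ _ => (hd τ).differentiableAt.differentiableWithinAt) fun τ hτ => ?_
      rw [interior_Icc] at hτ
      rw [(hd τ).deriv]
      have hmem : γ τ ∈ Set.uIcc s x := by
        rw [← segment_eq_uIcc]
        exact ⟨1 - τ, τ, by linarith [hτ.2], hτ.1.le, by ring, by simp [hγ]; ring⟩
      have h1 := h _ hmem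
      have e : γ τ - s = τ * (x - s) := by simp [hγ]
      rw [e, abs_mul, abs_of_pos hτ.1] at h1
      have h2 : |Φ' (γ τ)| * |x - s| ≤ B' (γ τ) * (x - s) := by
        refine le_of_mul_le_mul_left ?_ hτ.1
        linarith
      rw [← abs_mul] at h2
      have h3 : |ε * (Φ' (γ τ) * (x - s))| ≤ B' (γ τ) * (x - s) := by rwa [abs_mul, hε, one_mul]
      linarith [neg_abs_le (ε * (Φ' (γ τ) * (x - s)))]
    have := hmono (Set.left_mem_Icc.2 zero_le_one) (Set.right_mem_Icc.2 zero_le_one) zero_le_one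
    simpa [hγ, hΦs, hBs] using this
  have h1 := key 1 (by simp)
  have h2 := key (-1) (by simp)
  rw [abs_le]
  constructor <;> linarith

section Taylor

variable {g₀ g₁ g₂ g₃ g₄ : ℝ → ℝ} {x s : ℝ}

/-- The Taylor polynomial of order three, as a function of the centre `ξ`, has the derivative
`g₄ ξ * (s - ξ) ^ 3 / 6`. -/
lemma hasDerivAt_taylor_centre (h₀ : ∀ y, HasDerivAt g₀ (g₁ y) y)
    (h₁ : ∀ y, HasDerivAt g₁ (g₂ y) y) (h₂ : ∀ y, HasDerivAt g₂ (g₃ y) y)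
    (h₃ : ∀ y, HasDerivAt g₃ (g₄ y) y) (ξ : ℝ) :
    HasDerivAt (fun ξ => g₀ s - (g₀ ξ + g₁ ξ * (s - ξ) + g₂ ξ * ((s - ξ) ^ 2 / 2) +
      g₃ ξ * ((s - ξ) ^ 3 / 6))) (-(g₄ ξ * (s - ξ) ^ 3 / 6)) ξ := by
  have a : HasDerivAt (fun ξ => s - ξ) (-1) ξ := (hasDerivAt_id ξ).const_sub s
  have a2 : HasDerivAt (fun ξ => (s - ξ) ^ 2 / 2) (-(s - ξ)) ξ :=
    ((a.pow 2).div_const 2).congr_deriv (by ring)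
  have a3 : HasDerivAt (fun ξ => (s - ξ) ^ 3 / 6) (-((s - ξ) ^ 2 / 2)) ξ :=
    ((a.pow 3).div_const 6).congr_deriv (by ring)
  exact (((((h₀ ξ).add ((h₁ ξ).mul a)).add ((h₂ ξ).mul a2)).add ((h₃ ξ).mul a3)).const_sub
    (g₀ s)).congr_deriv (by ring)

lemma abs_taylor_remainder_le (h₀ : ∀ y, HasDerivAt g₀ (g₁ y) y)
    (h₁ : ∀ y, HasDerivAt g₁ (g₂ y) y) (h₂ : ∀ y, HasDerivAt g₂ (g₃ y) y)
    (h₃ : ∀ y, HasDerivAt g₃ (g₄ y) y) {D : ℝ} (hD : ∀ ξ ∈ Set.uIcc s x, |g₄ ξ| ≤ D) :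
    |g₀ s - (g₀ x + g₁ x * (s - x) + g₂ x * ((s - x) ^ 2 / 2) + g₃ x * ((s - x) ^ 3 / 6))| ≤
      D / 24 * (s - x) ^ 4 := by
  have hB : ∀ ξ, HasDerivAt (fun ξ => D / 24 * (s - ξ) ^ 4) (-(D / 6 * (s - ξ) ^ 3)) ξ := fun ξ =>
    ((((hasDerivAt_id ξ).const_sub s).pow 4).const_mul (D / 24)).congr_deriv (by simp; ring)
  refine abs_le_of_abs_deriv_mul_le (hasDerivAt_taylor_centre h₀ h₁ h₂ h₃) hB (by ring) (by ring)
    fun ξ hξ => ?_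
  rw [← abs_mul, show -(g₄ ξ * (s - ξ) ^ 3 / 6) * (ξ - s) = g₄ ξ * ((ξ - s) ^ 4 / 6) by ring,
    abs_mul, abs_of_nonneg (show 0 ≤ (ξ - s) ^ 4 / 6 by positivity)]
  calc |g₄ ξ| * ((ξ - s) ^ 4 / 6) ≤ D * ((ξ - s) ^ 4 / 6) :=
        mul_le_mul_of_nonneg_right (hD ξ hξ) (by positivity)
    _ = _ := by ring

/-- The Taylor remainder for a function whose fourth derivative is bounded by `K / y ^ 2`. The
singularity at `0` is harmless: the ratio `|s - ξ| / ξ` increases along the segment from `s` to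
`x`, so that `(s - ξ) ^ 2 / ξ ^ 2` is bounded by its value at `ξ = x`. -/
lemma abs_taylor_remainder_le_of_sq_mul (h₀ : ∀ y, HasDerivAt g₀ (g₁ y) y)
    (h₁ : ∀ y, HasDerivAt g₁ (g₂ y) y) (h₂ : ∀ y, HasDerivAt g₂ (g₃ y) y)
    (h₃ : ∀ y, HasDerivAt g₃ (g₄ y) y) {K : ℝ} (hK : ∀ ξ, 0 < ξ → ξ ^ 2 * |g₄ ξ| ≤ K)
    (hx : 0 < x) (hs : 0 ≤ s) :
    |g₀ s - (g₀ x + g₁ x * (s - x) + g₂ x * ((s - x) ^ 2 / 2) + g₃ x * ((s - x) ^ 3 / 6))| ≤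
      K / (12 * x ^ 2) * (s - x) ^ 4 := by
  have hB : ∀ ξ, HasDerivAt (fun ξ => K / (12 * x ^ 2) * (s - x) ^ 2 * (s - ξ) ^ 2)
      (-(K / (6 * x ^ 2) * (s - x) ^ 2 * (s - ξ))) ξ := fun ξ =>
    ((((hasDerivAt_id ξ).const_sub s).pow 2).const_mul
      (K / (12 * x ^ 2) * (s - x) ^ 2)).congr_deriv (by simp; field_simp; ring)
  rw [show K / (12 * x ^ 2) * (s - x) ^ 4 = K / (12 * x ^ 2) * (s - x) ^ 2 * (s - x) ^ 2 by ring]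
  refine abs_le_of_abs_deriv_mul_le (hasDerivAt_taylor_centre h₀ h₁ h₂ h₃) hB (by ring) (by ring)
    fun ξ hξ => ?_
  rw [← abs_mul, show -(g₄ ξ * (s - ξ) ^ 3 / 6) * (ξ - s) =
      g₄ ξ * (ξ - s) ^ 2 * ((ξ - s) ^ 2 / 6) by ring,
    abs_mul, abs_of_nonneg (show 0 ≤ (ξ - s) ^ 2 / 6 by positivity),
    show -(K / (6 * x ^ 2) * (s - x) ^ 2 * (s - ξ)) * (ξ - s) =
      K * (s - x) ^ 2 / x ^ 2 * ((ξ - s) ^ 2 / 6) by field_simp; ring]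
  refine mul_le_mul_of_nonneg_right ?_ (by positivity)
  have hξ0 : 0 ≤ ξ := by
    rcases Set.mem_uIcc.1 hξ with h | h <;> linarith [h.1]
  have hratio : (ξ - s) ^ 2 * x ^ 2 ≤ ξ ^ 2 * (s - x) ^ 2 := by
    rw [← mul_pow, ← mul_pow, sq_le_sq, abs_mul, abs_mul, abs_of_nonneg hξ0, abs_of_pos hx]
    rcases Set.mem_uIcc.1 hξ with h | h
    · rw [abs_of_nonneg (by linarith [h.1]), abs_of_nonpos (by linarith [h.1, h.2])]
      nlinarith [h.1, h.2]
    · rw [abs_of_nonpos (by linarith [h.2]), abs_of_nonneg (by linarith [h.1, h.2])]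
      nlinarith [h.1, h.2]
  rw [le_div_iff₀ (by positivity), abs_mul, abs_of_nonneg (sq_nonneg (ξ - s))]
  rcases hξ0.eq_or_lt with h0 | h0
  · -- here `ξ = 0`, which forces `s = 0`
    have hK0 : 0 ≤ K := (by positivity : (0 : ℝ) ≤ x ^ 2 * |g₄ x|).trans (hK x hx)
    have : (ξ - s) ^ 2 = 0 := by
      rw [← h0] at hratio ⊢
      have hs2 : s ^ 2 * x ^ 2 ≤ 0 := by linarith
      have : 0 < x ^ 2 := by positivity
      nlinarith [sq_nonneg s]
    rw [this]
    simp only [mul_zero, zero_mul]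
    positivity
  · calc |g₄ ξ| * (ξ - s) ^ 2 * x ^ 2 = |g₄ ξ| * ((ξ - s) ^ 2 * x ^ 2) := by ring
      _ ≤ |g₄ ξ| * (ξ ^ 2 * (s - x) ^ 2) := mul_le_mul_of_nonneg_left hratio (abs_nonneg _)
      _ = ξ ^ 2 * |g₄ ξ| * (s - x) ^ 2 := by ring
      _ ≤ K * (s - x) ^ 2 := mul_le_mul_of_nonneg_right (hK ξ h0) (sq_nonneg _)

end Taylor

/-! ### Moments of the gamma law -/

lemma gammaMeasure_Iio_zero (u r : ℝ) : gammaMeasure u r (Set.Iio 0) = 0 := by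
  rw [gammaMeasure, withDensity_apply _ measurableSet_Iio]
  exact lintegral_gammaPDF_of_nonpos le_rfl

lemma ae_nonneg_gammaMeasure (u r : ℝ) : ∀ᵐ s ∂gammaMeasure u r, 0 ≤ s := by
  rw [ae_iff]
  simpa [Set.Iio] using gammaMeasure_Iio_zero u r

lemma toReal_gammaPDF {u r : ℝ} (hu : 0 < u) (hr : 0 < r) (s : ℝ) :
    (gammaPDF u r s).toReal = gammaPDFReal u r s :=
  ENNReal.toReal_ofReal (gammaPDFReal_nonneg hu hr s)

lemma gammaPDFReal_mul_pow_eq_indicator {u : ℝ} (i : ℕ) :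
    ∀ᵐ s, gammaPDFReal u 1 s * s ^ i =
      (Set.Ioi 0).indicator (fun s => (Real.Gamma u)⁻¹ * (Real.exp (-s) * s ^ (u + i - 1))) s := by
  filter_upwards [Measure.ae_ne volume (0 : ℝ)] with s hs
  rcases lt_or_gt_of_ne hs with h | h
  · simp [gammaPDFReal, not_le.2 h, not_lt.2 h.le]
  · rw [Set.indicator_of_mem (Set.mem_Ioi.2 h), gammaPDFReal, if_pos h.le,
      show u + i - 1 = (u - 1) + i by ring, Real.rpow_add_natCast h.ne']
    simp
    ring

lemma integrable_pow_gammaMeasure {u : ℝ} (hu : 0 < u) (i : ℕ) :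
    Integrable (fun s => s ^ i) (gammaMeasure u 1) := by
  have hm : Measurable (gammaPDF u 1) := (measurable_gammaPDFReal u 1).ennreal_ofReal
  rw [gammaMeasure, integrable_withDensity_iff_integrable_smul' hm
    (Filter.Eventually.of_forall fun _ => ENNReal.ofReal_lt_top)]
  simp only [toReal_gammaPDF hu one_pos, smul_eq_mul]
  rw [integrable_congr (gammaPDFReal_mul_pow_eq_indicator i),
    integrable_indicator_iff measurableSet_Ioi]
  exact (Real.GammaIntegral_convergent (by positivity)).const_mul _

lemma integral_pow_gammaMeasure {u : ℝ} (hu : 0 < u) (i : ℕ) :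
    ∫ s, s ^ i ∂gammaMeasure u 1 = Real.Gamma (u + i) / Real.Gamma u := by
  have hm : Measurable (gammaPDF u 1) := (measurable_gammaPDFReal u 1).ennreal_ofReal
  rw [gammaMeasure, integral_withDensity_eq_integral_toReal_smul hm
    (Filter.Eventually.of_forall fun _ => ENNReal.ofReal_lt_top)]
  simp only [toReal_gammaPDF hu one_pos, smul_eq_mul]
  rw [integral_congr_ae (gammaPDFReal_mul_pow_eq_indicator i),
    integral_indicator measurableSet_Ioi, integral_const_mul,
    ← Real.Gamma_eq_integral (by positivity)]
  ring

/-- The integral of a cubic polynomial in `s / t` centred at the mean `x`, plus a multiple of the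
fourth centred moment, under the law of `S (t x)`. -/
lemma integral_centred_quartic {t x : ℝ} (ht : 0 < t) (hx : 0 < x) (b₀ b₁ b₂ b₃ b₄ : ℝ) :
    Integrable (fun s => b₀ + b₁ * (s / t - x) + b₂ * (s / t - x) ^ 2 + b₃ * (s / t - x) ^ 3 +
      b₄ * (s / t - x) ^ 4) (gammaMeasure (t * x) 1) ∧
    ∫ s, (b₀ + b₁ * (s / t - x) + b₂ * (s / t - x) ^ 2 + b₃ * (s / t - x) ^ 3 +
      b₄ * (s / t - x) ^ 4) ∂gammaMeasure (t * x) 1 =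
      b₀ + b₂ * (x / t) + b₃ * (2 * x / t ^ 2) + b₄ * (3 * x ^ 2 / t ^ 2 + 6 * x / t ^ 3) := by
  have hu : 0 < t * x := by positivity
  have hI := integrable_pow_gammaMeasure hu
  have hm := integral_pow_gammaMeasure hu
  have hG := (Real.Gamma_pos_of_pos hu).ne'
  have G1 : Real.Gamma (t * x + 1) = t * x * Real.Gamma (t * x) := Real.Gamma_add_one hu.ne'
  have G2 : Real.Gamma (t * x + 2) = (t * x + 1) * (t * x * Real.Gamma (t * x)) := by
    rw [← G1, ← Real.Gamma_add_one (by positivity)]; ring_nf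
  have G3 : Real.Gamma (t * x + 3) =
      (t * x + 2) * ((t * x + 1) * (t * x * Real.Gamma (t * x))) := by
    rw [← G2, ← Real.Gamma_add_one (by positivity)]; ring_nf
  have G4 : Real.Gamma (t * x + 4) =
      (t * x + 3) * ((t * x + 2) * ((t * x + 1) * (t * x * Real.Gamma (t * x)))) := by
    rw [← G3, ← Real.Gamma_add_one (by positivity)]; ring_nf
  have m0 := hm 0
  have m1 := hm 1
  have m2 := hm 2
  have m3 := hm 3
  have m4 := hm 4
  push_cast at m0 m1 m2 m3 m4
  rw [add_zero, div_self hG] at m0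
  rw [G1, mul_div_cancel_right₀ _ hG] at m1
  rw [G2, ← mul_assoc, mul_div_cancel_right₀ _ hG] at m2
  rw [G3, ← mul_assoc, ← mul_assoc, mul_div_cancel_right₀ _ hG] at m3
  rw [G4, ← mul_assoc, ← mul_assoc, ← mul_assoc, mul_div_cancel_right₀ _ hG] at m4
  set c₀ := b₀ - b₁ * x + b₂ * x ^ 2 - b₃ * x ^ 3 + b₄ * x ^ 4
  set c₁ := (b₁ - 2 * b₂ * x + 3 * b₃ * x ^ 2 - 4 * b₄ * x ^ 3) / t
  set c₂ := (b₂ - 3 * b₃ * x + 6 * b₄ * x ^ 2) / t ^ 2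
  set c₃ := (b₃ - 4 * b₄ * x) / t ^ 3
  set c₄ := b₄ / t ^ 4
  have e : (fun s => b₀ + b₁ * (s / t - x) + b₂ * (s / t - x) ^ 2 + b₃ * (s / t - x) ^ 3 +
      b₄ * (s / t - x) ^ 4) =
      fun s : ℝ => c₀ * s ^ 0 + c₁ * s ^ 1 + c₂ * s ^ 2 + c₃ * s ^ 3 + c₄ * s ^ 4 := by
    funext s
    simp only [c₀, c₁, c₂, c₃, c₄]
    ring
  have i0 := (hI 0).const_mul c₀
  have i1 := (hI 1).const_mul c₁
  have i2 := (hI 2).const_mul c₂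
  have i3 := (hI 3).const_mul c₃
  have i4 := (hI 4).const_mul c₄
  have i01 : Integrable (fun s => c₀ * s ^ 0 + c₁ * s ^ 1) (gammaMeasure (t * x) 1) := i0.add i1
  have i02 : Integrable (fun s => c₀ * s ^ 0 + c₁ * s ^ 1 + c₂ * s ^ 2)
    (gammaMeasure (t * x) 1) := i01.add i2
  have i03 : Integrable (fun s => c₀ * s ^ 0 + c₁ * s ^ 1 + c₂ * s ^ 2 + c₃ * s ^ 3)
    (gammaMeasure (t * x) 1) := i02.add i3
  rw [e]
  refine ⟨i03.add i4, ?_⟩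
  rw [integral_add i03 i4, integral_add i02 i3, integral_add i01 i2, integral_add i0 i1]
  simp only [integral_const_mul, m0, m1, m2, m3, m4]
  simp only [c₀, c₁, c₂, c₃, c₄]
  field_simp
  ring

/-! ### The operators at a point, from a Taylor expansion there -/

lemma gammaProcessLaw_of_pos {u : ℝ} (hu : 0 < u) : gammaProcessLaw u = gammaMeasure u 1 :=
  if_pos hu

instance isProbabilityMeasure_gammaProcessLaw (u : ℝ) :
    IsProbabilityMeasure (gammaProcessLaw u) := by
  unfold gammaProcessLaw
  split_ifs with h
  · exact isProbabilityMeasure_gammaMeasure h one_pos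
  · infer_instance

lemma ae_nonneg_gammaProcessLaw (u : ℝ) : ∀ᵐ s ∂gammaProcessLaw u, 0 ≤ s := by
  unfold gammaProcessLaw
  split_ifs with h
  · exact ae_nonneg_gammaMeasure u 1
  · rw [ae_dirac_iff measurableSet_Ici]

section Expansion

variable {t x c d₁ d₂ d₃ : ℝ} {g : ℝ → ℝ}

lemma abs_gammaOp_sub_le (ht : 0 < t) (hx : 0 < x)
    (hg : Integrable (fun s => g (s / t)) (gammaProcessLaw (t * x)))
    (hR : ∀ s, 0 ≤ s → |g s - (g x + d₁ * (s - x) + d₂ * ((s - x) ^ 2 / 2) +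
      d₃ * ((s - x) ^ 3 / 6))| ≤ c * (s - x) ^ 4) :
    |gammaOp t g x - (g x + d₂ * (x / (2 * t)) + d₃ * (x / (3 * t ^ 2)))| ≤
      c * (3 * x ^ 2 / t ^ 2 + 6 * x / t ^ 3) := by
  rw [gammaOp]
  rw [gammaProcessLaw_of_pos (by positivity)] at *
  obtain ⟨i1, e1⟩ := integral_centred_quartic ht hx (g x) d₁ (d₂ / 2) (d₃ / 6) 0
  obtain ⟨i2, e2⟩ := integral_centred_quartic ht hx 0 0 0 0 c
  have e : ∫ s, g (s / t) ∂gammaMeasure (t * x) 1 - (g x + d₂ * (x / (2 * t)) +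
      d₃ * (x / (3 * t ^ 2))) = ∫ s, (g (s / t) - (g x + d₁ * (s / t - x) +
        d₂ / 2 * (s / t - x) ^ 2 + d₃ / 6 * (s / t - x) ^ 3 + 0 * (s / t - x) ^ 4))
        ∂gammaMeasure (t * x) 1 := by
    rw [integral_sub hg i1, e1]
    field_simp
    ring
  rw [e, ← Real.norm_eq_abs]
  refine (norm_integral_le_of_norm_le i2 ?_).trans (le_of_eq ?_)
  · filter_upwards [ae_nonneg_gammaMeasure (t * x) 1] with s hs
    have := hR (s / t) (by positivity)
    rw [Real.norm_eq_abs]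
    convert this using 2 <;> ring
  · rw [e2]; ring

/-- In the Richardson combination the terms of order `1 / t` cancel. -/
lemma abs_gammaOp2_sub_le (ht : 0 < t) (hx : 0 < x)
    (hg : ∀ t, Integrable (fun s => g (s / t)) (gammaProcessLaw (t * x)))
    (hR : ∀ s, 0 ≤ s → |g s - (g x + d₁ * (s - x) + d₂ * ((s - x) ^ 2 / 2) +
      d₃ * ((s - x) ^ 3 / 6))| ≤ c * (s - x) ^ 4) :
    |gammaOp2 t g x - g x| ≤
      c * (9 / 2 * (x ^ 2 / t ^ 2) + 15 / 2 * (x / t ^ 3)) + |x * d₃| / (6 * t ^ 2) := by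
  have h1 := abs_gammaOp_sub_le ht hx (hg _) hR
  have h2 := abs_gammaOp_sub_le (t := 2 * t) (by positivity) hx (hg _) hR
  have e : gammaOp2 t g x - g x =
      2 * (gammaOp (2 * t) g x - (g x + d₂ * (x / (2 * (2 * t))) + d₃ * (x / (3 * (2 * t) ^ 2)))) -
      (gammaOp t g x - (g x + d₂ * (x / (2 * t)) + d₃ * (x / (3 * t ^ 2)))) -
      x * d₃ / (6 * t ^ 2) := by
    rw [gammaOp2]
    field_simp
    ring
  have h3 : |x * d₃ / (6 * t ^ 2)| = |x * d₃| / (6 * t ^ 2) := by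
    rw [abs_div, abs_of_pos (show 0 < 6 * t ^ 2 by positivity)]
  have e2 : c * (9 / 2 * (x ^ 2 / t ^ 2) + 15 / 2 * (x / t ^ 3)) =
      2 * (c * (3 * x ^ 2 / (2 * t) ^ 2 + 6 * x / (2 * t) ^ 3)) +
        c * (3 * x ^ 2 / t ^ 2 + 6 * x / t ^ 3) := by
    field_simp
    ring
  rw [e, e2, ← h3]
  refine (abs_sub _ _).trans (add_le_add_left ((abs_sub _ _).trans (add_le_add ?_ h1)) _)
  rw [abs_mul, abs_two]
  linarith

end Expansion

/-! ### Erlang distribution functions -/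

/-- The distribution function of the Erlang law with rate `1` and shape `m + 1`, as a smooth
function on the whole line; it agrees with `erlangCDF 1 (m + 1)` on `[0, ∞)`. -/
noncomputable def erlangSmooth (m : ℕ) (y : ℝ) : ℝ :=
  1 - ∑ i ∈ Finset.range (m + 1), poissonDiff 0 i y

lemma hasDerivAt_erlangSmooth (m : ℕ) (y : ℝ) :
    HasDerivAt (erlangSmooth m) (poissonDiff 0 m y) y := by
  have h : HasDerivAt (fun y => ∑ i ∈ Finset.range (m + 1), poissonDiff 0 i y)
      (∑ i ∈ Finset.range (m + 1), poissonDiff 1 i y) y :=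
    HasDerivAt.fun_sum fun i _ => hasDerivAt_poissonDiff 0 i y
  refine (h.const_sub 1).congr_deriv ?_
  induction m with
  | zero => simp [poissonDiff_succ_zero]
  | succ m ih =>
    rw [Finset.sum_range_succ, neg_add, ih, poissonDiff_succ_succ]
    · ring
    · exact HasDerivAt.fun_sum fun i _ => hasDerivAt_poissonDiff 0 i y

lemma erlangSmooth_zero (m : ℕ) : erlangSmooth m 0 = 0 := by
  simp [erlangSmooth, poissonDiff_zero, Finset.sum_range_succ']

lemma erlangCDF_one_eq_erlangSmooth (m : ℕ) {x : ℝ} (hx : 0 ≤ x) :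
    erlangCDF 1 (m + 1) x = erlangSmooth m x := by
  have hint : IntervalIntegrable (poissonDiff 0 m) volume 0 x :=
    Continuous.intervalIntegrable
      (continuous_iff_continuousAt.2 fun y => (hasDerivAt_poissonDiff 0 m y).continuousAt) _ _
  have hFTC := intervalIntegral.integral_eq_sub_of_hasDerivAt
    (fun y _ => hasDerivAt_erlangSmooth m y) hint
  rw [erlangSmooth_zero, sub_zero] at hFTC
  have hpos : (0 : ℝ) < ((m + 1 : ℕ) : ℝ) := by positivity
  rw [erlangCDF, cdf_gammaMeasure_eq_integral hpos one_pos, ← hFTC,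
    intervalIntegral.integral_of_le hx, ← integral_Icc_eq_integral_Ioc]
  rw [← integral_indicator measurableSet_Iic, ← integral_indicator measurableSet_Icc]
  congr 1
  funext y
  by_cases hy : 0 ≤ y
  · by_cases hyx : y ≤ x
    · rw [Set.indicator_of_mem (Set.mem_Iic.2 hyx), Set.indicator_of_mem (Set.mem_Icc.2 ⟨hy, hyx⟩),
        gammaPDFReal, if_pos hy, poissonDiff_zero]
      push_cast
      rw [Real.Gamma_nat_eq_factorial, Real.one_rpow, add_sub_cancel_right, Real.rpow_natCast,
        one_mul]
      ring
    · rw [Set.indicator_of_notMem (by simpa using hyx),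
        Set.indicator_of_notMem (fun h => hyx h.2)]
  · rw [Set.indicator_of_notMem (s := Set.Icc 0 x) (fun h => hy h.1), Set.indicator_apply]
    simp [gammaPDFReal, hy]

lemma erlangCDF_nonneg (a : ℝ) (j : ℕ) (x : ℝ) : 0 ≤ erlangCDF a j x := cdf_nonneg _ _

lemma erlangCDF_le_one (a : ℝ) (j : ℕ) (x : ℝ) : erlangCDF a j x ≤ 1 := cdf_le_one _ _

lemma measurable_erlangCDF (a : ℝ) (j : ℕ) : Measurable (erlangCDF a j) :=
  (monotone_cdf _).measurable

/-! ### The operators on functions with values in `[0, 1]` -/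

section Bounded

variable {g : ℝ → ℝ}

lemma integrable_comp_div (hg : Measurable g) (h0 : ∀ x, 0 ≤ g x) (h1 : ∀ x, g x ≤ 1) (t u : ℝ) :
    Integrable (fun s => g (s / t)) (gammaProcessLaw u) :=
  Integrable.of_bound (hg.comp (measurable_id.div_const t)).aestronglyMeasurable 1
    (Filter.Eventually.of_forall fun s => by
      rw [Real.norm_eq_abs, abs_of_nonneg (h0 _)]
      exact h1 _)

lemma gammaOp_mem_Icc (hg : Measurable g) (h0 : ∀ x, 0 ≤ g x) (h1 : ∀ x, g x ≤ 1) (t x : ℝ) :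
    gammaOp t g x ∈ Set.Icc (0 : ℝ) 1 := by
  refine ⟨integral_nonneg fun s => h0 _, ?_⟩
  refine (integral_mono (integrable_comp_div hg h0 h1 t _) (integrable_const 1)
    fun s => h1 _).trans ?_
  simp

lemma gammaOp2_mem_Icc (hg : Measurable g) (h0 : ∀ x, 0 ≤ g x) (h1 : ∀ x, g x ≤ 1) (t x : ℝ) :
    gammaOp2 t g x ∈ Set.Icc (-1 : ℝ) 2 := by
  have a := gammaOp_mem_Icc hg h0 h1 t x
  have b := gammaOp_mem_Icc hg h0 h1 (2 * t) x
  constructor <;> simp only [gammaOp2] <;> linarith [a.1, a.2, b.1, b.2]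

lemma abs_interpOp2_sub_le_two (hg : Measurable g) (h0 : ∀ x, 0 ≤ g x) (h1 : ∀ x, g x ≤ 1)
    (t x : ℝ) : |interpOp2 t g x - g x| ≤ 2 := by
  have a := gammaOp2_mem_Icc hg h0 h1 t (((⌊t * x⌋ : ℝ) + 1) / t)
  have b := gammaOp2_mem_Icc hg h0 h1 t ((⌊t * x⌋ : ℝ) / t)
  have f1 := Int.floor_le (t * x)
  have f2 := (Int.lt_floor_add_one (t * x)).le
  have hm := (convex_Icc (-1 : ℝ) 2) a b (sub_nonneg.2 f1) (sub_nonneg.2 f2) (by ring)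
  simp only [smul_eq_mul] at hm
  rw [interpOp2, abs_le]
  constructor <;> linarith [hm.1, hm.2, h0 x, h1 x]

lemma gammaOp2_zero (t : ℝ) : gammaOp2 t g 0 = g 0 := by
  simp [gammaOp2, gammaOp, gammaProcessLaw]
  ring

end Bounded

/-! ### The error for a single Erlang law -/

/-- The error of `gammaOp2` at the points `k / t`. For `k ≥ 2` the fourth derivative is controlled
with the weight `y ^ 2`; for `k = 1` the fourth centred moment is of order `1 / t ^ 4`, so a
constant bound on that derivative suffices. -/
lemma abs_gammaOp2_erlangCDF_sub_le (m k : ℕ) {t : ℝ} (ht : 1 ≤ t) :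
    |gammaOp2 t (erlangCDF 1 (m + 1)) (k / t) - erlangCDF 1 (m + 1) (k / t)| ≤
      (31 / 24 + 27 / (16 * Real.exp 1)) / t ^ 2 := by
  have ht0 : 0 < t := by linarith
  have hsq : Real.exp (-1 / 2) ^ 2 = 1 / Real.exp 1 := by
    rw [← Real.exp_nat_mul, one_div, ← Real.exp_neg]; norm_num
  have he : 1 / Real.exp 1 ≤ 0.368 := by
    rw [div_le_iff₀ (Real.exp_pos 1)]
    linarith [Real.exp_one_gt_d9]
  have he' : 0.36 ≤ 1 / Real.exp 1 := by
    rw [le_div_iff₀ (Real.exp_pos 1)]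
    linarith [Real.exp_one_lt_d9]
  have h27 : 27 / (16 * Real.exp 1) = 27 / 16 * (1 / Real.exp 1) := by field_simp
  have hs2 : √2 ≤ 1.415 := Real.sqrt_le_iff.2 (by norm_num)
  rw [h27]
  rcases Nat.eq_zero_or_pos k with rfl | hk
  · rw [Nat.cast_zero, zero_div, gammaOp2_zero, sub_self, abs_zero]
    positivity
  have hk0 : (0 : ℝ) < k := by exact_mod_cast hk
  set x : ℝ := k / t with hx
  have hx0 : 0 < x := by positivity
  have hint : ∀ t, Integrable (fun s => erlangCDF 1 (m + 1) (s / t)) (gammaProcessLaw (t * x)) :=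
    fun t => integrable_comp_div (measurable_erlangCDF _ _) (erlangCDF_nonneg _ _)
      (erlangCDF_le_one _ _) t _
  have hd := fun i y => hasDerivAt_poissonDiff i m y
  have h2 : |x * poissonDiff 2 m x| / (6 * t ^ 2) ≤ √2 / 6 / t ^ 2 := by
    rw [div_div]
    exact div_le_div_of_nonneg_right (abs_mul_poissonDiff_two_le m hx0) (by positivity)
  rcases Nat.eq_or_lt_of_le (Nat.succ_le_of_lt hk) with hk1 | hk2
  · have hx1 : x = 1 / t := by rw [hx, ← hk1]; simp
    have h := abs_gammaOp2_sub_le (d₁ := poissonDiff 0 m x) (d₂ := poissonDiff 1 m x)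
      (d₃ := poissonDiff 2 m x) (c := 3 / 24) ht0 hx0 hint fun s hs => by
        rw [erlangCDF_one_eq_erlangSmooth m hs, erlangCDF_one_eq_erlangSmooth m hx0.le]
        refine abs_taylor_remainder_le (hasDerivAt_erlangSmooth m) (hd 0) (hd 1) (hd 2)
          fun ξ hξ => abs_poissonDiff_three_le_three m ?_
        rcases Set.mem_uIcc.1 hξ with h | h <;> linarith [h.1]
    refine h.trans ((add_le_add_right h2 _).trans ?_)
    have e : 3 / 24 * (9 / 2 * (x ^ 2 / t ^ 2) + 15 / 2 * (x / t ^ 3))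
        = 3 / 2 * (1 / t ^ 2) / t ^ 2 := by
      rw [hx1]; field_simp; ring
    have ht2 : 1 / t ^ 2 ≤ 1 := by
      rw [div_le_one (by positivity)]; exact one_le_pow₀ ht
    rw [e, ← add_div]
    exact div_le_div_of_nonneg_right (by linarith) (by positivity)
  · have hk2' : (2 : ℝ) ≤ k := by exact_mod_cast hk2
    set E := Real.exp (-1 / 2)
    have hE : 0 < E := Real.exp_pos _
    have h := abs_gammaOp2_sub_le (d₁ := poissonDiff 0 m x) (d₂ := poissonDiff 1 m x)
      (d₃ := poissonDiff 2 m x) (c := 4 * E / (12 * x ^ 2)) ht0 hx0 hint fun s hs => by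
        rw [erlangCDF_one_eq_erlangSmooth m hs, erlangCDF_one_eq_erlangSmooth m hx0.le]
        exact abs_taylor_remainder_le_of_sq_mul (hasDerivAt_erlangSmooth m) (hd 0) (hd 1) (hd 2)
          (fun ξ hξ => sq_mul_abs_poissonDiff_three_le m hξ) hx0 hs
    refine h.trans ((add_le_add_right h2 _).trans ?_)
    have e : 4 * E / (12 * x ^ 2) * (9 / 2 * (x ^ 2 / t ^ 2) + 15 / 2 * (x / t ^ 3)) =
        E * (3 / 2 + 5 / 2 * (1 / k)) / t ^ 2 := by
      rw [hx]; field_simp; ring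
    have hk3 : 1 / (k : ℝ) ≤ 1 / 2 := one_div_le_one_div_of_le two_pos hk2'
    have hE2 : E ≤ 0.607 := by nlinarith
    rw [e, ← add_div, ← hsq]
    refine div_le_div_of_nonneg_right ?_ (by positivity)
    have : E * (3 / 2 + 5 / 2 * (1 / k)) ≤ E * (11 / 4) :=
      mul_le_mul_of_nonneg_left (by linarith) hE.le
    nlinarith

lemma abs_erlangCDF_sub_sub_le (m : ℕ) {x s : ℝ} (hx : 0 ≤ x) (hs : 0 ≤ s) :
    |erlangCDF 1 (m + 1) s - erlangCDF 1 (m + 1) x - poissonDiff 0 m x * (s - x)| ≤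
      (s - x) ^ 2 / 2 := by
  rw [erlangCDF_one_eq_erlangSmooth m hs, erlangCDF_one_eq_erlangSmooth m hx]
  have hΦ : ∀ ξ, HasDerivAt (fun ξ => erlangSmooth m s - (erlangSmooth m ξ +
      poissonDiff 0 m ξ * (s - ξ))) (-(poissonDiff 1 m ξ * (s - ξ))) ξ := fun ξ =>
    (((hasDerivAt_erlangSmooth m ξ).add ((hasDerivAt_poissonDiff 0 m ξ).mul
      ((hasDerivAt_id ξ).const_sub s))).const_sub _).congr_deriv (by simp)
  have hB : ∀ ξ, HasDerivAt (fun ξ => (s - ξ) ^ 2 / 2) (-(s - ξ)) ξ := fun ξ =>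
    ((((hasDerivAt_id ξ).const_sub s).pow 2).div_const 2).congr_deriv (by simp; ring)
  have := abs_le_of_abs_deriv_mul_le (x := x) hΦ hB (by ring) (by ring) fun ξ hξ => by
    have hξ0 : 0 ≤ ξ := by
      rcases Set.mem_uIcc.1 hξ with h | h <;> linarith [h.1]
    rw [← abs_mul, show -(poissonDiff 1 m ξ * (s - ξ)) * (ξ - s) =
      poissonDiff 1 m ξ * (ξ - s) ^ 2 by ring, abs_mul, abs_of_nonneg (sq_nonneg (ξ - s)),
      show -(s - ξ) * (ξ - s) = 1 * (ξ - s) ^ 2 by ring]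
    exact mul_le_mul_of_nonneg_right (abs_poissonDiff_one_le_one m hξ0) (sq_nonneg _)
  rwa [← sub_sub] at this

/-- The error for one Erlang law of rate `1`: for `t ≤ 1` the bound exceeds the trivial bound `2`;
otherwise the error at the points `k / t` and the error of linear interpolation add up. -/
lemma abs_interpOp2_erlangCDF_one_sub_le (m : ℕ) {t x : ℝ} (ht : 0 < t) (hx : 0 ≤ x) :
    |interpOp2 t (erlangCDF 1 (m + 1)) x - erlangCDF 1 (m + 1) x| ≤
      (17 / 12 + 27 / (16 * Real.exp 1)) / t ^ 2 := by
  rcases le_total t 1 with ht1 | ht1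
  · refine (abs_interpOp2_sub_le_two (measurable_erlangCDF _ _) (erlangCDF_nonneg _ _)
      (erlangCDF_le_one _ _) t x).trans ?_
    have h1 : t ^ 2 ≤ 1 := pow_le_one₀ ht.le ht1
    have h2 : 7 / 12 ≤ 27 / (16 * Real.exp 1) := by
      rw [le_div_iff₀ (by positivity)]
      linarith [Real.exp_one_lt_d9]
    rw [le_div_iff₀ (by positivity)]
    linarith
  · obtain ⟨k, hk⟩ := Int.eq_ofNat_of_zero_le (Int.floor_nonneg.2 (show 0 ≤ t * x by positivity))
    have f1 := Int.floor_le (t * x)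
    have f2 := (Int.lt_floor_add_one (t * x)).le
    rw [interpOp2]
    rw [hk] at *
    push_cast at *
    have ga := abs_gammaOp2_erlangCDF_sub_le m k ht1
    have gb := abs_gammaOp2_erlangCDF_sub_le m (k + 1) ht1
    push_cast at gb
    have ha := abs_erlangCDF_sub_sub_le m hx (show 0 ≤ (k : ℝ) / t by positivity)
    have hb := abs_erlangCDF_sub_sub_le m hx (show 0 ≤ ((k : ℝ) + 1) / t by positivity)
    set F := erlangCDF 1 (m + 1)
    set θ := t * x - k with hθ
    set C := (31 / 24 + 27 / (16 * Real.exp 1)) / t ^ 2 with hC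
    have e1 : ((k : ℝ) + 1) / t - x = (1 - θ) / t := by rw [hθ]; field_simp; ring
    have e2 : (k : ℝ) / t - x = -θ / t := by rw [hθ]; field_simp; ring
    rw [e1] at hb
    rw [e2] at ha
    have e3 : (k : ℝ) + 1 - t * x = 1 - θ := by rw [hθ]; ring
    rw [e3]
    have hθ0 : 0 ≤ θ := by linarith
    have hθ1 : 0 ≤ 1 - θ := by linarith
    have e : θ * gammaOp2 t F ((k + 1) / t) + (1 - θ) * gammaOp2 t F (k / t) - F x =
        θ * ((gammaOp2 t F ((k + 1) / t) - F ((k + 1) / t)) +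
          (F ((k + 1) / t) - F x - poissonDiff 0 m x * ((1 - θ) / t))) +
        (1 - θ) * ((gammaOp2 t F (k / t) - F (k / t)) +
          (F (k / t) - F x - poissonDiff 0 m x * (-θ / t))) := by
      ring
    rw [e]
    refine (abs_add_le _ _).trans ?_
    rw [abs_mul, abs_mul, abs_of_nonneg hθ0, abs_of_nonneg hθ1]
    have b1 := mul_le_mul_of_nonneg_left ((abs_add_le _ _).trans (add_le_add gb hb)) hθ0
    have b2 := mul_le_mul_of_nonneg_left ((abs_add_le _ _).trans (add_le_add ga ha)) hθ1
    refine (add_le_add b1 b2).trans ?_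
    have e4 : θ * (C + ((1 - θ) / t) ^ 2 / 2) + (1 - θ) * (C + (-θ / t) ^ 2 / 2) =
        C + θ * (1 - θ) / 2 / t ^ 2 := by
      field_simp; ring
    rw [e4, hC, ← add_div]
    refine div_le_div_of_nonneg_right ?_ (by positivity)
    nlinarith [sq_nonneg (θ - 1 / 2)]

/-! ### Change of scale -/

lemma erlangCDF_eq_erlangCDF_one (m : ℕ) {a : ℝ} (ha : 0 < a) (x : ℝ) :
    erlangCDF a (m + 1) x = erlangCDF 1 (m + 1) (a * x) := by
  have hpos : (0 : ℝ) < ((m + 1 : ℕ) : ℝ) := by positivity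
  rw [erlangCDF, erlangCDF, cdf_gammaMeasure_eq_integral hpos ha,
    cdf_gammaMeasure_eq_integral hpos one_pos]
  rw [← integral_indicator measurableSet_Iic, ← integral_indicator measurableSet_Iic]
  have h := Measure.integral_comp_mul_left
    ((Set.Iic (a * x)).indicator (gammaPDFReal ((m + 1 : ℕ) : ℝ) 1)) a
  rw [abs_of_pos (inv_pos.2 ha), smul_eq_mul, eq_inv_mul_iff_mul_eq₀ ha.ne',
    ← integral_const_mul] at h
  rw [← h]
  congr 1
  funext y
  by_cases hyx : y ≤ x
  swap
  · rw [Set.indicator_of_notMem (by simpa using hyx),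
      Set.indicator_of_notMem (by simpa [ha] using hyx), mul_zero]
  rw [Set.indicator_of_mem (Set.mem_Iic.2 hyx),
    Set.indicator_of_mem (Set.mem_Iic.2 (mul_le_mul_of_nonneg_left hyx ha.le))]
  by_cases hy : 0 ≤ y
  · have hay : 0 ≤ a * y := by positivity
    simp only [gammaPDFReal, hy, hay, if_true]
    rw [Real.mul_rpow ha.le hy, Real.one_rpow, show a ^ (((m + 1 : ℕ) : ℝ)) =
      a * a ^ (((m + 1 : ℕ) : ℝ) - 1) by rw [← Real.rpow_one_add' ha.le (by linarith)]; ring_nf]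
    ring_nf
  · have hay : ¬ 0 ≤ a * y := by
      rw [not_le] at hy ⊢; exact mul_neg_of_pos_of_neg ha hy
    simp [gammaPDFReal, hy, hay]

lemma gammaOp_comp_mul {a : ℝ} (ha : 0 < a) (t : ℝ) (g : ℝ → ℝ) (x : ℝ) :
    gammaOp t (fun y => g (a * y)) x = gammaOp (t / a) g (a * x) := by
  have h1 : t / a * (a * x) = t * x := by field_simp
  have h2 : ∀ s : ℝ, a * (s / t) = s / (t / a) := fun s => by rw [div_div_eq_mul_div]; ring
  simp only [gammaOp, h1, h2]

lemma interpOp2_comp_mul {a : ℝ} (ha : 0 < a) (t : ℝ) (g : ℝ → ℝ) (x : ℝ) :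
    interpOp2 t (fun y => g (a * y)) x = interpOp2 (t / a) g (a * x) := by
  have h1 : t / a * (a * x) = t * x := by field_simp
  have h2 : ∀ s : ℝ, a * (s / t) = s / (t / a) := fun s => by rw [div_div_eq_mul_div]; ring
  simp only [interpOp2, gammaOp2, gammaOp_comp_mul ha, h1, h2, mul_div_assoc]

lemma abs_interpOp2_erlangCDF_sub_le (m : ℕ) {a t x : ℝ} (ha : 0 < a) (ht : 0 < t) (hx : 0 ≤ x) :
    |interpOp2 t (erlangCDF a (m + 1)) x - erlangCDF a (m + 1) x| ≤
      (17 / 12 + 27 / (16 * Real.exp 1)) * (a ^ 2 / t ^ 2) := by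
  have h : erlangCDF a (m + 1) = fun y => erlangCDF 1 (m + 1) (a * y) :=
    funext (erlangCDF_eq_erlangCDF_one m ha)
  rw [h, interpOp2_comp_mul ha]
  refine (abs_interpOp2_erlangCDF_one_sub_le m (div_pos ht ha) (by positivity)).trans (le_of_eq ?_)
  field_simp

/-! ### Mixtures of Erlang laws with a common rate -/

/-- The Erlang law with rate `a` and shape `j`, where the shape `0` stands for the point mass
at `0`; it is the law of the sum of `j` independent exponential variables of rate `a`. -/
noncomputable def erlangMeasure (a : ℝ) (j : ℕ) : Measure ℝ :=
  if j = 0 then Measure.dirac 0 else gammaMeasure j a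

lemma erlangMeasure_zero (a : ℝ) : erlangMeasure a 0 = Measure.dirac 0 := if_pos rfl

lemma erlangMeasure_succ (a : ℝ) (j : ℕ) :
    erlangMeasure a (j + 1) = gammaMeasure ((j + 1 : ℕ) : ℝ) a := if_neg j.succ_ne_zero

lemma isProbabilityMeasure_erlangMeasure {a : ℝ} (ha : 0 < a) (j : ℕ) :
    IsProbabilityMeasure (erlangMeasure a j) := by
  rcases j with _ | j
  · rw [erlangMeasure_zero]; infer_instance
  · rw [erlangMeasure_succ]
    exact isProbabilityMeasure_gammaMeasure (by positivity) ha

lemma integrableOn_pow_mul_cexp_neg_mul {r : ℂ} (hr : 0 < r.re) (j : ℕ) :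
    IntegrableOn (fun x : ℝ => (x : ℂ) ^ j * Complex.exp (-(r * x))) (Set.Ioi 0) := by
  have h := integrableOn_rpow_mul_exp_neg_mul_rpow (s := j) (p := 1) (b := r.re)
    (by linarith [Nat.cast_nonneg (α := ℝ) j]) one_pos hr
  refine Integrable.mono' h (by fun_prop) ?_
  filter_upwards [ae_restrict_mem measurableSet_Ioi] with x hx
  rw [norm_mul, norm_pow, Complex.norm_real, Complex.norm_exp, Real.norm_of_nonneg (le_of_lt hx)]
  simp

/-- The gamma integral at integer exponents, with a complex rate. -/
lemma integral_pow_mul_cexp_neg_mul {r : ℂ} (hr : 0 < r.re) (j : ℕ) :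
    ∫ x : ℝ in Set.Ioi 0, (x : ℂ) ^ j * Complex.exp (-(r * x)) = j.factorial / r ^ (j + 1) := by
  have hr0 : r ≠ 0 := fun h => by simp [h] at hr
  induction j with
  | zero =>
    have h := integral_exp_mul_complex_Ioi (a := -r) (by simpa using hr) 0
    simp only [neg_mul] at h
    simp [h]
  | succ j ih =>
    have h0 := integrableOn_pow_mul_cexp_neg_mul hr j
    have h1 := integrableOn_pow_mul_cexp_neg_mul hr (j + 1)
    have hd : ∀ x : ℝ, HasDerivAt
        (fun x : ℝ => (x : ℂ) ^ (j + 1) * Complex.exp (-(r * x)))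
        ((j + 1) * ((x : ℂ) ^ j * Complex.exp (-(r * x))) -
          r * ((x : ℂ) ^ (j + 1) * Complex.exp (-(r * x)))) x := fun x => by
      have e1 : HasDerivAt (fun z : ℂ => z ^ (j + 1) * Complex.exp (-(r * z)))
          ((j + 1) * ((x : ℂ) ^ j * Complex.exp (-(r * x))) -
            r * ((x : ℂ) ^ (j + 1) * Complex.exp (-(r * x)))) (x : ℂ) :=
        ((hasDerivAt_pow (j + 1) (x : ℂ)).mul
          (((hasDerivAt_id (x : ℂ)).const_mul r).neg.cexp)).congr_deriv (by simp; ring)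
      exact e1.comp_ofReal
    have hi := (h0.const_mul ((j : ℂ) + 1)).sub (h1.const_mul r)
    have key := integral_Ioi_of_hasDerivAt_of_tendsto' (fun x _ => hd x) hi
      (tendsto_zero_of_hasDerivAt_of_integrableOn_Ioi (fun x _ => hd x) hi h1)
    rw [integral_sub (h0.const_mul _) (h1.const_mul _), integral_const_mul, integral_const_mul,
      ih] at key
    simp only [Complex.ofReal_zero, zero_pow j.succ_ne_zero, zero_mul, sub_zero] at key
    rw [eq_div_iff (pow_ne_zero _ hr0), pow_succ r (j + 1)]
    rw [mul_div_assoc', sub_eq_zero, div_eq_iff (pow_ne_zero _ hr0)] at key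
    rw [Nat.factorial_succ]
    push_cast
    linear_combination -key

lemma charFun_erlangMeasure {a : ℝ} (ha : 0 < a) (j : ℕ) (s : ℝ) :
    charFun (erlangMeasure a j) s = ((a : ℂ) / (a - s * Complex.I)) ^ j := by
  rcases j with _ | j
  · rw [erlangMeasure_zero, charFun_dirac]; simp
  have hu : (0 : ℝ) < ((j + 1 : ℕ) : ℝ) := by positivity
  have hm : Measurable (gammaPDF ((j + 1 : ℕ) : ℝ) a) :=
    (measurable_gammaPDFReal _ a).ennreal_ofReal
  rw [erlangMeasure_succ, charFun_apply_real, gammaMeasure,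
    integral_withDensity_eq_integral_toReal_smul hm
      (Filter.Eventually.of_forall fun _ => ENNReal.ofReal_lt_top)]
  simp only [toReal_gammaPDF hu ha]
  have hre : 0 < ((a : ℂ) - s * Complex.I).re := by simpa using ha
  have e : ∀ᵐ x : ℝ, gammaPDFReal ((j + 1 : ℕ) : ℝ) a x • Complex.exp (s * x * Complex.I) =
      (Set.Ioi 0).indicator (fun x : ℝ => (a : ℂ) ^ (j + 1) / j.factorial *
        ((x : ℂ) ^ j * Complex.exp (-((a - s * Complex.I) * x)))) x := by
    filter_upwards [Measure.ae_ne volume (0 : ℝ)] with x hx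
    rcases lt_or_gt_of_ne hx with h | h
    · simp [gammaPDFReal, not_le.2 h, not_lt.2 h.le]
    · rw [Set.indicator_of_mem (Set.mem_Ioi.2 h), gammaPDFReal, if_pos h.le, Real.rpow_natCast]
      push_cast
      rw [Real.Gamma_nat_eq_factorial, add_sub_cancel_right, Real.rpow_natCast,
        Complex.real_smul]
      push_cast
      rw [show -(((a : ℂ) - s * Complex.I) * x) = -(a * x) + s * x * Complex.I by ring,
        Complex.exp_add]
      ring
  rw [integral_congr_ae e, integral_indicator measurableSet_Ioi, integral_const_mul,
    integral_pow_mul_cexp_neg_mul hre]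
  have : (j.factorial : ℂ) ≠ 0 := by exact_mod_cast j.factorial_ne_zero
  rw [div_pow]
  field_simp

lemma erlangMeasure_conv {a : ℝ} (ha : 0 < a) (i j : ℕ) :
    (erlangMeasure a i).conv (erlangMeasure a j) = erlangMeasure a (i + j) := by
  have := isProbabilityMeasure_erlangMeasure ha
  refine Measure.ext_of_charFun (funext fun s => ?_)
  rw [charFun_conv]
  simp only [charFun_erlangMeasure ha, pow_add]

/-- The mixtures, finite or infinite, of Erlang laws with rate `a` and of the point mass at `0`.
The total mass is not fixed. -/
def IsErlangMixtureMeasure (a : ℝ) (ν : Measure ℝ) : Prop :=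
  ∃ q : ℕ → ℝ≥0∞, ν = Measure.sum fun j => q j • erlangMeasure a j

namespace IsErlangMixtureMeasure

variable {a : ℝ}

lemma erlangMeasure (j : ℕ) : IsErlangMixtureMeasure a (erlangMeasure a j) := by
  refine ⟨Pi.single j 1, Measure.ext fun s hs => ?_⟩
  rw [Measure.sum_apply _ hs, tsum_eq_single j fun i hi => by simp [hi]]
  simp

lemma sum {ι : Type*} {ν : ι → Measure ℝ} (h : ∀ i, IsErlangMixtureMeasure a (ν i))
    (c : ι → ℝ≥0∞) : IsErlangMixtureMeasure a (Measure.sum fun i => c i • ν i) := by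
  choose q hq using h
  refine ⟨fun j => ∑' i, c i * q i j, Measure.ext fun s hs => ?_⟩
  simp only [Measure.sum_apply _ hs, Measure.smul_apply, smul_eq_mul, hq, ← ENNReal.tsum_mul_left,
    ← ENNReal.tsum_mul_right, ← mul_assoc]
  exact ENNReal.tsum_comm

lemma add {ν ρ : Measure ℝ} (hν : IsErlangMixtureMeasure a ν) (hρ : IsErlangMixtureMeasure a ρ) :
    IsErlangMixtureMeasure a (ν + ρ) := by
  obtain ⟨q, rfl⟩ := hν
  obtain ⟨r, rfl⟩ := hρ
  exact ⟨q + r, by simp only [Measure.sum_add_sum, Pi.add_apply, add_smul]⟩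

lemma smul {ν : Measure ℝ} (hν : IsErlangMixtureMeasure a ν) (c : ℝ≥0∞) :
    IsErlangMixtureMeasure a (c • ν) := by
  simpa using sum (fun _ : Unit => hν) fun _ => c

lemma conv (ha : 0 < a) {ν ρ : Measure ℝ} (hν : IsErlangMixtureMeasure a ν)
    (hρ : IsErlangMixtureMeasure a ρ) : IsErlangMixtureMeasure a (ν.conv ρ) := by
  have hprob := isProbabilityMeasure_erlangMeasure ha
  obtain ⟨q, rfl⟩ := hν
  obtain ⟨r, rfl⟩ := hρ
  have e : (Measure.sum fun j => q j • GammaApprox.erlangMeasure a j).conv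
      (Measure.sum fun j => r j • GammaApprox.erlangMeasure a j) =
      Measure.sum fun p : ℕ × ℕ => (q p.1 * r p.2) • GammaApprox.erlangMeasure a (p.1 + p.2) := by
    rw [Measure.conv, Measure.prod_sum, Measure.map_sum (by fun_prop)]
    congr 1
    funext p
    rw [← erlangMeasure_conv ha, Measure.prod_smul_left, Measure.prod_smul_right, smul_smul,
      Measure.map_smul, Measure.conv]
  rw [e]
  exact sum (fun p : ℕ × ℕ => erlangMeasure (p.1 + p.2)) fun p => q p.1 * r p.2

/-- An exponential variable of rate `b ≤ a` is a geometric sum of exponential variables of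
rate `a`. -/
lemma gammaMeasure_one {b : ℝ} (hb : 0 < b) (hba : b ≤ a) :
    IsErlangMixtureMeasure a (gammaMeasure 1 b) := by
  have ha : 0 < a := hb.trans_le hba
  have hr : 0 ≤ (a - b) / a := div_nonneg (sub_nonneg.2 hba) ha.le
  have e : gammaMeasure 1 b = Measure.sum fun l : ℕ =>
      ENNReal.ofReal (b / a * ((a - b) / a) ^ l) • GammaApprox.erlangMeasure a (l + 1) := by
    have hd : gammaPDF 1 b = ∑' l : ℕ, ENNReal.ofReal (b / a * ((a - b) / a) ^ l) •
        gammaPDF ((l + 1 : ℕ) : ℝ) a := by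
      funext y
      rw [tsum_apply (by exact Pi.summable.2 fun y => ENNReal.summable)]
      simp only [Pi.smul_apply, smul_eq_mul]
      rcases lt_or_ge y 0 with hy | hy
      · simp [gammaPDF_of_neg hy]
      · have hs : HasSum (fun l : ℕ => b * Real.exp (-(a * y)) * (((a - b) * y) ^ l / l.factorial))
            (b * Real.exp (-(a * y)) * Real.exp ((a - b) * y)) := by
          have := NormedSpace.expSeries_div_hasSum_exp (𝔸 := ℝ) ((a - b) * y)
          rw [← Real.exp_eq_exp_ℝ] at this
          exact this.mul_left _
        have hnn : ∀ l : ℕ, 0 ≤ b * Real.exp (-(a * y)) * (((a - b) * y) ^ l / l.factorial) :=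
          fun l => by
            have : 0 ≤ (a - b) * y := mul_nonneg (sub_nonneg.2 hba) hy
            positivity
        have h1 : gammaPDF 1 b y =
            ENNReal.ofReal (b * Real.exp (-(a * y)) * Real.exp ((a - b) * y)) := by
          rw [gammaPDF_of_nonneg hy, mul_assoc b, ← Real.exp_add,
            show -(a * y) + (a - b) * y = -(b * y) by ring]
          simp
        rw [h1, ← hs.tsum_eq, ENNReal.ofReal_tsum_of_nonneg hnn hs.summable]
        refine tsum_congr fun l => ?_
        rw [gammaPDF_of_nonneg hy, ← ENNReal.ofReal_mul (by positivity), Real.rpow_natCast]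
        push_cast
        rw [Real.Gamma_nat_eq_factorial, add_sub_cancel_right, Real.rpow_natCast, mul_pow, div_pow,
          pow_succ]
        congr 1
        field_simp
    have hpm : ∀ u, Measurable (gammaPDF u a) := fun u =>
      (measurable_gammaPDFReal u a).ennreal_ofReal
    rw [gammaMeasure, hd, withDensity_tsum fun l => (hpm _).const_smul _]
    congr 1
    funext l
    rw [withDensity_smul _ (hpm _), erlangMeasure_succ, gammaMeasure]
  rw [e]
  exact sum (fun l => erlangMeasure (l + 1)) _

lemma of_rate_le {b : ℝ} (hb : 0 < b) (hba : b ≤ a) (j : ℕ) :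
    IsErlangMixtureMeasure a (GammaApprox.erlangMeasure b j) := by
  induction j with
  | zero =>
    rw [erlangMeasure_zero, ← erlangMeasure_zero a]
    exact erlangMeasure 0
  | succ j ih =>
    rw [← erlangMeasure_conv hb]
    refine conv (hb.trans_le hba) ih ?_
    rw [← zero_add 1, erlangMeasure_succ]
    simpa using gammaMeasure_one hb hba

end IsErlangMixtureMeasure

/-! ### Laws of random sums -/

section RandomSum

variable {Ω : Type*} [MeasurableSpace Ω] {μ : Measure Ω}

lemma isErlangMixtureMeasure_map_of_isErlangMixture [IsProbabilityMeasure μ] {n : ℕ}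
    {a : Fin n → ℝ} {A : ℝ}
    (ha_pos : ∀ i, 0 < a i) (ha_le : ∀ i, a i ≤ A) {Y : Ω → ℝ} (hY : Measurable Y)
    (hY0 : ∀ᵐ ω ∂μ, 0 ≤ Y ω) (h : IsErlangMixture a (distFun μ Y)) :
    IsErlangMixtureMeasure A (μ.map Y) := by
  obtain ⟨w, hw0, hws, hw1, hF⟩ := h
  have : IsProbabilityMeasure (μ.map Y) := Measure.isProbabilityMeasure_map hY.aemeasurable
  have hprob := fun i => isProbabilityMeasure_erlangMeasure (ha_pos i)
  have e : μ.map Y = ENNReal.ofReal (1 - ∑ i, ∑' j, w i j) • erlangMeasure A 0 +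
      Measure.sum fun i => (1 : ℝ≥0∞) •
        Measure.sum fun j => ENNReal.ofReal (w i j) • erlangMeasure (a i) (j + 1) := by
    refine Measure.ext_of_Iic _ _ fun x => ?_
    simp only [Measure.add_apply, Measure.smul_apply, Measure.sum_apply _ measurableSet_Iic,
      smul_eq_mul, one_mul, tsum_fintype, erlangMeasure_zero, erlangMeasure_succ]
    rcases lt_or_ge x 0 with hx | hx
    · have h1 : μ.map Y (Set.Iic x) = 0 := by
        rw [Measure.map_apply hY measurableSet_Iic]
        refine measure_mono_null (fun ω hω => ?_) hY0
        simp only [Set.mem_preimage, Set.mem_Iic] at hω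
        simp only [Set.mem_compl_iff, Set.mem_ofPred_eq, not_le]
        exact hω.trans_lt hx
      have h2 : ∀ u r, gammaMeasure u r (Set.Iic x) = 0 := fun u r =>
        measure_mono_null (fun y hy => lt_of_le_of_lt hy hx) (gammaMeasure_Iio_zero u r)
      simp [h1, h2, hx]
    · have hcdf : ∀ i j, gammaMeasure ((j + 1 : ℕ) : ℝ) (a i) (Set.Iic x) =
          ENNReal.ofReal (erlangCDF (a i) (j + 1) x) := fun i j => by
        have := hprob i (j + 1)
        rw [erlangMeasure_succ] at this
        rw [erlangCDF, ofReal_cdf]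
      have hnn : ∀ i j, 0 ≤ w i j * erlangCDF (a i) (j + 1) x := fun i j =>
        mul_nonneg (hw0 i j) (erlangCDF_nonneg _ _ _)
      have hsum : ∀ i, Summable fun j => w i j * erlangCDF (a i) (j + 1) x := fun i =>
        (hws i).of_nonneg_of_le (hnn i) fun j =>
          mul_le_of_le_one_right (hw0 i j) (erlangCDF_le_one _ _ _)
      have hF' : μ.map Y (Set.Iic x) = ENNReal.ofReal (distFun μ Y x) := by
        rw [distFun, ofReal_cdf]
      rw [hF', hF x hx, ENNReal.ofReal_add (sub_nonneg.2 hw1)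
        (Finset.sum_nonneg fun i _ => tsum_nonneg (hnn i)),
        ENNReal.ofReal_sum_of_nonneg fun i _ => tsum_nonneg (hnn i)]
      simp only [hcdf, ENNReal.ofReal_tsum_of_nonneg (hnn _) (hsum _), ENNReal.ofReal_mul (hw0 _ _)]
      simp [hx]
  rw [e]
  exact ((IsErlangMixtureMeasure.erlangMeasure 0).smul _).add (IsErlangMixtureMeasure.sum
    (fun i => IsErlangMixtureMeasure.sum
      (fun j => IsErlangMixtureMeasure.of_rate_le (ha_pos i) (ha_le i) (j + 1)) _) _)

lemma isErlangMixtureMeasure_map_sum_range [IsProbabilityMeasure μ] {A : ℝ} (hA : 0 < A)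
    {X : ℕ → Ω → ℝ} (hX_meas : ∀ i, Measurable (X i)) (hX_indep : iIndepFun X μ)
    (hX : ∀ i, IsErlangMixtureMeasure A (μ.map (X i))) (m : ℕ) :
    IsErlangMixtureMeasure A (μ.map (∑ i ∈ Finset.range m, X i)) := by
  induction m with
  | zero =>
    rw [Finset.sum_range_zero, show (0 : Ω → ℝ) = fun _ => 0 from rfl, Measure.map_const,
      measure_univ, one_smul, ← erlangMeasure_zero A]
    exact IsErlangMixtureMeasure.erlangMeasure 0
  | succ m ih =>
    rw [Finset.sum_range_succ]
    have hind : IndepFun (∑ i ∈ Finset.range m, X i) (X m) μ :=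
      hX_indep.indepFun_finsetSum_of_notMem hX_meas Finset.notMem_range_self
    rw [hind.map_add_eq_map_conv_map₀
      (Finset.sum_induction _ Measurable (fun _ _ => Measurable.add) measurable_zero
      fun i _ => hX_meas i).aemeasurable (hX_meas m).aemeasurable]
    exact ih.conv hA (hX m)

lemma map_randomSum {X : ℕ → Ω → ℝ} (hX_meas : ∀ i, Measurable (X i)) {M : Ω → ℕ}
    (hM_meas : Measurable M) (hM_indep : IndepFun M (fun ω i => X i ω) μ) :
    Measurable (randomSum X M) ∧ μ.map (randomSum X M) =
      Measure.sum fun m => μ (M ⁻¹' {m}) • μ.map (∑ i ∈ Finset.range m, X i) := by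
  have hS : ∀ m, Measurable (∑ i ∈ Finset.range m, X i) := fun m =>
    Finset.sum_induction _ Measurable (fun _ _ => Measurable.add) measurable_zero
      fun i _ => hX_meas i
  have hpre : ∀ B : Set ℝ, randomSum X M ⁻¹' B =
      ⋃ m, M ⁻¹' {m} ∩ (∑ i ∈ Finset.range m, X i) ⁻¹' B := fun B => by
    ext ω
    simp [randomSum, Finset.sum_apply]
  have hmeas : ∀ B, MeasurableSet B → ∀ m,
      MeasurableSet (M ⁻¹' {m} ∩ (∑ i ∈ Finset.range m, X i) ⁻¹' B) := fun B hB m =>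
    (hM_meas (measurableSet_singleton m)).inter (hS m hB)
  have hR : Measurable (randomSum X M) := fun B hB => by
    rw [hpre]
    exact MeasurableSet.iUnion (hmeas B hB)
  refine ⟨hR, Measure.ext fun B hB => ?_⟩
  rw [Measure.map_apply hR hB, hpre, measure_iUnion ?_ (hmeas B hB), Measure.sum_apply _ hB]
  · refine tsum_congr fun m => ?_
    rw [Measure.smul_apply, smul_eq_mul, Measure.map_apply (hS m) hB]
    have hf : Measurable fun x : ℕ → ℝ => ∑ i ∈ Finset.range m, x i :=
      Finset.measurable_fun_sum _ fun i _ => measurable_pi_apply i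
    have h := (hM_indep.comp measurable_id hf).measure_inter_preimage_eq_mul {m} B
      (measurableSet_singleton m) hB
    have e : (fun x : ℕ → ℝ => ∑ i ∈ Finset.range m, x i) ∘ (fun ω i => X i ω) =
        ∑ i ∈ Finset.range m, X i := by
      funext ω
      simp [Finset.sum_apply]
    rw [e] at h
    simpa using h
  · intro i j hij
    refine Set.disjoint_left.2 fun ω h1 h2 => hij ?_
    exact (h1.1 : M ω = i).symm.trans h2.1

end RandomSum

/-! ### The error for a mixture -/

section Mixture

variable {f : ℕ → ℝ → ℝ} {p : ℕ → ℝ} {g : ℝ → ℝ}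

lemma hasSum_gammaOp (hf : ∀ j, Measurable (f j)) (hf0 : ∀ j x, 0 ≤ f j x)
    (hf1 : ∀ j x, f j x ≤ 1) (hp : ∀ j, 0 ≤ p j) (hps : Summable p)
    (hg : ∀ x, HasSum (fun j => p j * f j x) (g x)) (t x : ℝ) :
    HasSum (fun j => p j * gammaOp t (f j) x) (gammaOp t g x) := by
  have hint : ∀ j, Integrable (fun s => p j * f j (s / t)) (gammaProcessLaw (t * x)) := fun j =>
    (integrable_comp_div (hf j) (hf0 j) (hf1 j) t _).const_mul _
  have h := hasSum_integral_of_summable_integral_norm hint (hps.of_nonneg_of_le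
    (fun j => integral_nonneg fun s => norm_nonneg _) fun j => ?_)
  · simp only [integral_const_mul, (hg _).tsum_eq] at h
    exact h
  · refine (integral_mono (hint j).norm (integrable_const (p j)) fun s => ?_).trans (by simp)
    simp only [Real.norm_eq_abs]
    rw [abs_of_nonneg (mul_nonneg (hp j) (hf0 _ _))]
    exact mul_le_of_le_one_right (hp j) (hf1 _ _)

lemma hasSum_interpOp2 (hf : ∀ j, Measurable (f j)) (hf0 : ∀ j x, 0 ≤ f j x)
    (hf1 : ∀ j x, f j x ≤ 1) (hp : ∀ j, 0 ≤ p j) (hps : Summable p)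
    (hg : ∀ x, HasSum (fun j => p j * f j x) (g x)) (t x : ℝ) :
    HasSum (fun j => p j * interpOp2 t (f j) x) (interpOp2 t g x) := by
  have h2 : ∀ x, HasSum (fun j => p j * gammaOp2 t (f j) x) (gammaOp2 t g x) := fun x => by
    have := ((hasSum_gammaOp hf hf0 hf1 hp hps hg (2 * t) x).mul_left 2).sub
      (hasSum_gammaOp hf hf0 hf1 hp hps hg t x)
    rw [show (fun j => p j * gammaOp2 t (f j) x) = fun j =>
      2 * (p j * gammaOp (2 * t) (f j) x) - p j * gammaOp t (f j) x from
        funext fun j => by rw [gammaOp2]; ring]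
    exact this
  have := ((h2 (((⌊t * x⌋ : ℝ) + 1) / t)).mul_left (t * x - ⌊t * x⌋)).add
    ((h2 ((⌊t * x⌋ : ℝ) / t)).mul_left (⌊t * x⌋ + 1 - t * x))
  rw [show (fun j => p j * interpOp2 t (f j) x) = fun j =>
    (t * x - ⌊t * x⌋) * (p j * gammaOp2 t (f j) (((⌊t * x⌋ : ℝ) + 1) / t)) +
      (⌊t * x⌋ + 1 - t * x) * (p j * gammaOp2 t (f j) ((⌊t * x⌋ : ℝ) / t)) from
        funext fun j => by rw [interpOp2]; ring]
  exact this

end Mixture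

lemma cdf_dirac_zero {x : ℝ} (hx : 0 ≤ x) : cdf (Measure.dirac (0 : ℝ)) x = 1 := by
  rw [cdf_eq_real]
  simp [measureReal_def, hx]

lemma interpOp2_cdf_dirac_zero {t x : ℝ} (ht : 0 < t) :
    interpOp2 t (cdf (Measure.dirac (0 : ℝ))) x = 1 := by
  have h : ∀ t, 0 < t → ∀ x, gammaOp t (cdf (Measure.dirac (0 : ℝ))) x = 1 := fun t ht x => by
    rw [gammaOp, integral_congr_ae (g := fun _ => (1 : ℝ))]
    · simp
    · filter_upwards [ae_nonneg_gammaProcessLaw (t * x)] with s hs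
      exact cdf_dirac_zero (by positivity)
  simp only [interpOp2, gammaOp2, h t ht, h (2 * t) (by positivity)]
  ring

/-- The error is linear in the law, and it vanishes for the point mass at `0`: only the mass
`1 - cdf ν 0` of the proper Erlang components contributes. -/
lemma abs_interpOp2_cdf_sub_le {A : ℝ} (hA : 0 < A) {ν : Measure ℝ} [IsProbabilityMeasure ν]
    (hν : IsErlangMixtureMeasure A ν) {t x : ℝ} (ht : 0 < t) (hx : 0 ≤ x) :
    |interpOp2 t (cdf ν) x - cdf ν x| ≤
      (17 / 12 + 27 / (16 * Real.exp 1)) * ((1 - cdf ν 0) * A ^ 2 / t ^ 2) := by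
  obtain ⟨q, hq⟩ := hν
  have hprob := isProbabilityMeasure_erlangMeasure hA
  have hmass : ∑' j, q j = 1 := by
    have h : ν Set.univ = 1 := measure_univ
    rw [hq, Measure.sum_apply _ MeasurableSet.univ] at h
    simpa using h
  have hqtop : ∀ j, q j ≠ ∞ := ENNReal.ne_top_of_tsum_ne_top (by rw [hmass]; simp)
  set p : ℕ → ℝ := fun j => (q j).toReal
  have hp0 : ∀ j, 0 ≤ p j := fun j => ENNReal.toReal_nonneg
  have hp1 : HasSum p 1 := by
    have h := ENNReal.hasSum_toReal (f := q) (by rw [hmass]; simp)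
    rwa [← ENNReal.tsum_toReal_eq hqtop, hmass, ENNReal.toReal_one] at h
  set f : ℕ → ℝ → ℝ := fun j => cdf (erlangMeasure A j) with hf
  have hf0 : ∀ j x, 0 ≤ f j x := fun j x => cdf_nonneg _ _
  have hf1 : ∀ j x, f j x ≤ 1 := fun j x => cdf_le_one _ _
  have hfm : ∀ j, Measurable (f j) := fun j => (monotone_cdf _).measurable
  have hg : ∀ x, HasSum (fun j => p j * f j x) (cdf ν x) := fun x => by
    have h1 : ν (Set.Iic x) = ∑' j, q j * erlangMeasure A j (Set.Iic x) := by
      rw [hq, Measure.sum_apply _ measurableSet_Iic]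
      rfl
    have h := ENNReal.hasSum_toReal (f := fun j => q j * erlangMeasure A j (Set.Iic x))
      (by rw [← h1]; exact measure_ne_top _ _)
    rw [← ENNReal.tsum_toReal_eq fun j => ENNReal.mul_ne_top (hqtop j) (measure_ne_top _ _),
      ← h1] at h
    simpa only [ENNReal.toReal_mul, hf, p, cdf_eq_real, measureReal_def] using h
  have hsucc : ∀ j, f (j + 1) = erlangCDF A (j + 1) := fun j => by
    simp only [hf, erlangMeasure_succ]
    rfl
  have hdiff := (hasSum_interpOp2 hfm hf0 hf1 hp0 hp1.summable hg t x).sub (hg x)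
  have hbound := ((hp1.sub (hg 0)).mul_left
    ((17 / 12 + 27 / (16 * Real.exp 1)) * (A ^ 2 / t ^ 2)))
  have hle : ∀ j, |p j * interpOp2 t (f j) x - p j * f j x| ≤
      (17 / 12 + 27 / (16 * Real.exp 1)) * (A ^ 2 / t ^ 2) * (p j - p j * f j 0) := fun j => by
    rw [← mul_sub, abs_mul, abs_of_nonneg (hp0 j)]
    rcases j with _ | j
    · have : f 0 = cdf (Measure.dirac (0 : ℝ)) := by simp only [hf, erlangMeasure_zero]
      rw [this, interpOp2_cdf_dirac_zero ht, cdf_dirac_zero hx, cdf_dirac_zero le_rfl]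
      simp
    · rw [hsucc, erlangCDF_eq_erlangCDF_one j hA 0, mul_zero,
        erlangCDF_one_eq_erlangSmooth j le_rfl, erlangSmooth_zero, mul_zero, sub_zero,
        mul_comm _ (p (j + 1))]
      exact mul_le_mul_of_nonneg_left (abs_interpOp2_erlangCDF_sub_le j hA ht hx) (hp0 _)
  have := tsum_of_norm_bounded (f := fun j => p j * interpOp2 t (f j) x - p j * f j x) hbound hle
  rw [hdiff.tsum_eq, Real.norm_eq_abs] at this
  exact this.trans (le_of_eq (by ring))

end GammaApprox

theorem mainTheorem5 {Ω : Type*} [MeasurableSpace Ω] (μ : Measure Ω) [IsProbabilityMeasure μ]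
    (n : ℕ) (a : Fin (n + 1) → ℝ) (ha_pos : ∀ i, 0 < a i) (ha_mono : StrictMono a)
    (X : ℕ → Ω → ℝ) (hX_meas : ∀ i, Measurable (X i))
    (hX_nonneg : ∀ i, ∀ᵐ ω ∂μ, 0 ≤ X i ω)
    (hX_indep : iIndepFun X μ)
    (hX_ident : ∀ i, IdentDistrib (X i) (X 0) μ μ)
    (hX_erlang : GammaApprox.IsErlangMixture a (GammaApprox.distFun μ (X 0)))
    (M : Ω → ℕ) (hM_meas : Measurable M)
    (hM_indep : IndepFun M (fun ω i => X i ω) μ)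
    (G : ℝ → ℝ) (hG : G = GammaApprox.distFun μ (GammaApprox.randomSum X M))
    (t : ℝ) (ht : 0 < t) :
    GammaApprox.supNorm (fun x => GammaApprox.interpOp2 t G x - G x) ≤
      ENNReal.ofReal ((17 / 12 + 27 / (16 * Real.exp 1)) *
        ((1 - G 0) * a (Fin.last n) ^ 2 / t ^ 2)) := by
  have hX : ∀ i, GammaApprox.IsErlangMixtureMeasure (a (Fin.last n)) (μ.map (X i)) := fun i => by
    rw [(hX_ident i).map_eq]
    exact GammaApprox.isErlangMixtureMeasure_map_of_isErlangMixture ha_pos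
      (fun i => ha_mono.monotone (Fin.le_last i)) (hX_meas 0) (hX_nonneg 0) hX_erlang
  obtain ⟨hR, hlaw⟩ := GammaApprox.map_randomSum hX_meas hM_meas hM_indep
  have hmix : GammaApprox.IsErlangMixtureMeasure (a (Fin.last n))
      (μ.map (GammaApprox.randomSum X M)) := by
    rw [hlaw]
    exact GammaApprox.IsErlangMixtureMeasure.sum (fun m =>
      GammaApprox.isErlangMixtureMeasure_map_sum_range (ha_pos _) hX_meas hX_indep hX m) _
  have := Measure.isProbabilityMeasure_map (μ := μ) hR.aemeasurable
  have hG' : G = cdf (μ.map (GammaApprox.randomSum X M)) := hG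
  rw [hG']
  exact iSup_le fun x => ENNReal.ofReal_le_ofReal
    (GammaApprox.abs_interpOp2_cdf_sub_le (ha_pos _) hmix ht x.2)
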